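/- Let $\Omega=(0,1)^2\subset\mathbb R^2$, $a>0$, $0<\alpha<1$, and for $\epsilon>0$ let $h_\epsilon(x_1,x_2)=\bigl(x_1,\;x_2+x_2\,\epsilon\sin(x_1/\epsilon^{\alpha})\bigr)$, $\Omega_\epsilon=h_\epsilon(\Omega)$, and $|Jh_\epsilon|$ the absolute value of the Jacobian determinant of $h_\epsilon$. Write $h_\epsilon^{*}v=v\circ h_\epsilon$ and $h_\epsilon^{*-1}u=u\circ h_\epsilon^{-1}$. Let $H^1(\Omega)$ be the Sobolev space of complex-valued functions with its usual norm and $H^{-1}(\Omega)$ its dual, with the dual norm, and let $H^1(\Omega)$ be included in $H^{-1}(\Omega)$ by $\langle u,\psi\rangle_{-1,1}=\int_\Omega u\psi\,dx$. Let $A$ and $A_\epsilon$ be the operators in $H^{-1}(\Omega)$ with domain $H^1(\Omega)$ that are defined, for all $u,\psi\in H^1(\Omega)$, by $$\langle Au,\psi\rangle_{-1,1}=\int_\Omega\nabla u\cdot\nabla\psi\,dx+a\int_\Omega u\psi\,dx,$$ $$\langle A_\epsilon u,\psi\rangle_{-1,1}=\int_\Omega\bigl(h_\epsilon^{*}\nabla_{\Omega_\epsilon}h_\epsilon^{*-1}u\bigr)\cdot\Bigl(h_\epsilon^{*}\nabla_{\Omega_\epsilon}h_\epsilon^{*-1}\tfrac{\psi}{|Jh_\epsilon|}\Bigr)\,|Jh_\epsilon|\,dx+a\int_\Omega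 u\psi\,dx ,$$ where $v\cdot w=v_1w_1+v_2w_2$ (no complex conjugation). Call a linear operator $B$ in a complex Banach space $X$ sectorial if it is closed and densely defined and there are $\theta\in(0,\pi/2)$, $M\ge1$ and $b\in\mathbb R$ such that every $\lambda\neq b$ with $\theta\le|\arg(\lambda-b)|\le\pi$ lies in the resolvent set of $B$ and satisfies $\|(\lambda-B)^{-1}\|\le M/|\lambda-b|$. Then there are $\epsilon_0>0$, depending only on $a$ and $\alpha$, and a function $\tau$, with $\tau(\epsilon)>0$ for $0<\epsilon<\epsilon_0$ and $\tau(\epsilon)\to0$ as $\epsilon\to0^+$, such that for every $\epsilon\in(0,\epsilon_0)$ the operator $A_\epsilon$ is well defined and sectorial in $H^{-1}(\Omega)$, and $$\|(A_\epsilon-A)u\|_{H^{-1}(\Omega)}\le\tau(\epsilon)\,\|Au\|_{H^{-1}(\Omega)}\qquad\text{for all }u\in H^1(\Omega).$$ -/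

import Mathlib

open MeasureTheory Set Filter Topology
open scoped ContDiff

noncomputable section

/-- The Euclidean plane. -/
abbrev Plane : Type := EuclideanSpace ℝ (Fin 2)

/-- The open unit square `(0,1) × (0,1)`. -/
def unitSquare : Set Plane := {x | ∀ i, x i ∈ Ioo (0 : ℝ) 1}

/-- The partial derivative `∂φ/∂xᵢ` of a real function on the plane. -/
def partialDeriv (i : Fin 2) (φ : Plane → ℝ) (x : Plane) : ℝ :=
  fderiv ℝ φ x (EuclideanSpace.single i 1)

/-- `g` is the weak (distributional) gradient of `f` in the open set `U`: for every
`φ ∈ C_c^∞(U)`, `∫_U (∂ᵢφ) f = - ∫_U φ gᵢ`. -/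
def IsWeakGradient (U : Set Plane) (f : Plane → ℂ) (g : Plane → EuclideanSpace ℂ (Fin 2)) : Prop :=
  ∀ φ : Plane → ℝ, ContDiff ℝ ∞ φ → HasCompactSupport φ → tsupport φ ⊆ U → ∀ i : Fin 2,
    ∫ x in U, (partialDeriv i φ x : ℂ) * f x = -∫ x in U, (φ x : ℂ) * g x i

lemma partialDeriv_memLp {φ : Plane → ℝ} (hφ : ContDiff ℝ ∞ φ) (hc : HasCompactSupport φ)
    (U : Set Plane) (i : Fin 2) :
    MemLp (fun x => (partialDeriv i φ x : ℂ)) 2 (volume.restrict U) := by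
  have h1 : Continuous (fun x => partialDeriv i φ x) :=
    (hφ.continuous_fderiv (by simp)).clm_apply continuous_const
  have h2 : HasCompactSupport (fun x => partialDeriv i φ x) :=
    hc.fderiv_apply (𝕜 := ℝ) (EuclideanSpace.single i 1)
  exact ((h1.memLp_of_hasCompactSupport (μ := volume.restrict U) h2).ofReal)

lemma testFunction_memLp {φ : Plane → ℝ} (hφ : ContDiff ℝ ∞ φ) (hc : HasCompactSupport φ)
    (U : Set Plane) : MemLp (fun x => (φ x : ℂ)) 2 (volume.restrict U) :=
  ((hφ.continuous.memLp_of_hasCompactSupport (μ := volume.restrict U) hc).ofReal)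

lemma coord_memLp {U : Set Plane} {g : Plane → EuclideanSpace ℂ (Fin 2)}
    (hg : MemLp g 2 (volume.restrict U)) (i : Fin 2) :
    MemLp (fun x => g x i) 2 (volume.restrict U) :=
  (EuclideanSpace.proj (𝕜 := ℂ) i).comp_memLp' hg

/-- The Sobolev space `H¹(U)` of complex valued functions, with the norm
`(‖u‖²_{L²(U)} + ‖∇u‖²_{L²(U)})^{1/2}`. It is realized as the subspace of `L²(U) × L²(U)²` of
all the pairs `(u, ∇u)`; the second component is determined by the first one. -/
def sobolevH1 (U : Set Plane) :
    Submodule ℂ (WithLp 2 (Lp ℂ 2 (volume.restrict U) ×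
      Lp (EuclideanSpace ℂ (Fin 2)) 2 (volume.restrict U))) where
  carrier := {p | IsWeakGradient U p.fst p.snd}
  zero_mem' := by
    intro φ hφ hc hs i
    have h1 : ∫ x in U, (partialDeriv i φ x : ℂ) * (0 : Lp ℂ 2 (volume.restrict U)) x = 0 := by
      rw [← integral_zero Plane ℂ (μ := volume.restrict U)]
      refine integral_congr_ae ?_
      filter_upwards [Lp.coeFn_zero ℂ 2 (volume.restrict U)] with x hx
      rw [hx]
      simp
    have h2 : ∫ x in U, (φ x : ℂ) *
        (0 : Lp (EuclideanSpace ℂ (Fin 2)) 2 (volume.restrict U)) x i = 0 := by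
      rw [← integral_zero Plane ℂ (μ := volume.restrict U)]
      refine integral_congr_ae ?_
      filter_upwards [Lp.coeFn_zero (EuclideanSpace ℂ (Fin 2)) 2 (volume.restrict U)] with x hx
      rw [hx]
      simp
    simp only [WithLp.zero_fst, WithLp.zero_snd]
    rw [h1, h2, neg_zero]
  add_mem' := by
    intro p q hp hq φ hφ hc hs i
    have e1 : ∫ x in U, (partialDeriv i φ x : ℂ) * (p + q).fst x =
        ∫ x in U, ((partialDeriv i φ x : ℂ) * p.fst x + (partialDeriv i φ x : ℂ) * q.fst x) := by
      refine integral_congr_ae ?_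
      filter_upwards [Lp.coeFn_add p.fst q.fst] with x hx
      rw [WithLp.add_fst, hx, Pi.add_apply, mul_add]
    have e2 : ∫ x in U, (φ x : ℂ) * (p + q).snd x i =
        ∫ x in U, ((φ x : ℂ) * p.snd x i + (φ x : ℂ) * q.snd x i) := by
      refine integral_congr_ae ?_
      filter_upwards [Lp.coeFn_add p.snd q.snd] with x hx
      rw [WithLp.add_snd, hx, Pi.add_apply, PiLp.add_apply, mul_add]
    have m1 := partialDeriv_memLp hφ hc U i
    have m2 := testFunction_memLp hφ hc U
    have i1 : Integrable (fun x => (partialDeriv i φ x : ℂ) * p.fst x) (volume.restrict U) :=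
      m1.integrable_mul (Lp.memLp p.fst)
    have i2 : Integrable (fun x => (partialDeriv i φ x : ℂ) * q.fst x) (volume.restrict U) :=
      m1.integrable_mul (Lp.memLp q.fst)
    have i3 : Integrable (fun x => (φ x : ℂ) * p.snd x i) (volume.restrict U) :=
      m2.integrable_mul (coord_memLp (Lp.memLp p.snd) i)
    have i4 : Integrable (fun x => (φ x : ℂ) * q.snd x i) (volume.restrict U) :=
      m2.integrable_mul (coord_memLp (Lp.memLp q.snd) i)
    rw [e1, e2, integral_add i1 i2, integral_add i3 i4, hp φ hφ hc hs i, hq φ hφ hc hs i]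
    ring
  smul_mem' := by
    intro c p hp φ hφ hc hs i
    have e1 : ∫ x in U, (partialDeriv i φ x : ℂ) * (c • p).fst x =
        ∫ x in U, c * ((partialDeriv i φ x : ℂ) * p.fst x) := by
      refine integral_congr_ae ?_
      filter_upwards [Lp.coeFn_smul c p.fst] with x hx
      rw [WithLp.smul_fst, hx, Pi.smul_apply, smul_eq_mul]
      ring
    have e2 : ∫ x in U, (φ x : ℂ) * (c • p).snd x i =
        ∫ x in U, c * ((φ x : ℂ) * p.snd x i) := by
      refine integral_congr_ae ?_
      filter_upwards [Lp.coeFn_smul c p.snd] with x hx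
      rw [WithLp.smul_snd, hx, Pi.smul_apply, PiLp.smul_apply, smul_eq_mul]
      ring
    rw [e1, e2, integral_const_mul, integral_const_mul, hp φ hφ hc hs i]
    ring

/-- `H¹(U)` as a (complex) normed space. -/
abbrev H1 (U : Set Plane) : Type := ↥(sobolevH1 U)

/-- The function underlying an element of `H¹(U)`. -/
def H1.val {U : Set Plane} (u : H1 U) : Plane → ℂ := u.1.fst

/-- The weak gradient of an element of `H¹(U)`. -/
def H1.grad {U : Set Plane} (u : H1 U) : Plane → EuclideanSpace ℂ (Fin 2) := u.1.snd

/-- `H⁻¹(U)`, the dual space of `H¹(U)`, with the dual norm. -/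
abbrev Hneg1 (U : Set Plane) : Type := StrongDual ℂ (H1 U)

/-- The inclusion `H¹(U) ⊆ L²(U)`. -/
def H1.toL2 (U : Set Plane) : H1 U →L[ℂ] Lp ℂ 2 (volume.restrict U) :=
  (WithLp.fstL 2 ℂ (Lp ℂ 2 (volume.restrict U))
    (Lp (EuclideanSpace ℂ (Fin 2)) 2 (volume.restrict U))).comp (sobolevH1 U).subtypeL

/-- The canonical inclusion `H¹(U) ⊆ H⁻¹(U)`, which sends `u` to `ψ ↦ ∫_U u ψ`. -/
def H1.toHneg1 (U : Set Plane) : H1 U →ₗ[ℂ] Hneg1 U where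
  toFun u := (((ContinuousLinearMap.mul ℂ ℂ).lpPairing (volume.restrict U) 2 2)
    (H1.toL2 U u)).comp (H1.toL2 U)
  map_add' u v := by ext ψ; simp
  map_smul' c u := by ext ψ; simp

lemma H1.toHneg1_apply {U : Set Plane} (u ψ : H1 U) :
    H1.toHneg1 U u ψ = ∫ x in U, u.val x * ψ.val x := by
  change (ContinuousLinearMap.mul ℂ ℂ).lpPairing (volume.restrict U) 2 2
    (H1.toL2 U u) (H1.toL2 U ψ) = _
  rw [ContinuousLinearMap.lpPairing_eq_integral]
  rfl

/-- `f` represents an element of `H¹(U)`. -/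
def MemH1 (U : Set Plane) (f : Plane → ℂ) : Prop :=
  ∃ v : H1 U, v.val =ᵐ[volume.restrict U] f

open scoped Classical in
/-- The weak gradient in `U` of a function of class `H¹(U)` (set to `0` for all other functions). -/
def weakGradient (U : Set Plane) (f : Plane → ℂ) : Plane → EuclideanSpace ℂ (Fin 2) :=
  if hf : MemH1 U f then hf.choose.grad else 0

/-- The function `(h^*)⁻¹ f = f ∘ h⁻¹` on `h(U)`. -/
def pushForward (h : Plane → Plane) (U : Set Plane) (f : Plane → ℂ) : Plane → ℂ :=
  fun y => f (Function.invFunOn h U y)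

/-- The pulled back gradient `h^* ∇_{h(U)} (h^*)⁻¹ f`. -/
def pulledBackGradient (h : Plane → Plane) (U : Set Plane) (f : Plane → ℂ) :
    Plane → EuclideanSpace ℂ (Fin 2) :=
  fun x => weakGradient (h '' U) (pushForward h U f) (h x)

/-- `|Jh(x)|`, the absolute value of the jacobian determinant of `h`. -/
def absJacobian (h : Plane → Plane) (x : Plane) : ℝ := |(fderiv ℝ h x).det|

/-- The function `ψ / |Jh|`. -/
def divJacobian (h : Plane → Plane) (ψ : Plane → ℂ) : Plane → ℂ :=
  fun x => ψ x / (absJacobian h x : ℂ)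

/-- The pulled back bilinear form of `-Δ + a`:
`∫_U (h^*∇_{h(U)}(h^*)⁻¹ u) · (h^*∇_{h(U)}(h^*)⁻¹ (ψ/|Jh|)) |Jh| dx + a ∫_U u ψ dx`. -/
def pulledBackForm (a : ℝ) (h : Plane → Plane) (U : Set Plane) (u ψ : H1 U) : ℂ :=
  (∫ x in U, (∑ i, pulledBackGradient h U u.val x i *
      pulledBackGradient h U (divJacobian h ψ.val) x i) * (absJacobian h x : ℂ))
    + (a : ℂ) * ∫ x in U, u.val x * ψ.val x

/-- All the functions that are differentiated in `pulledBackForm` are of class `H¹` in `h(U)`. -/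
def PulledBackFormWellDefined (h : Plane → Plane) (U : Set Plane) : Prop :=
  ∀ u : H1 U, MemH1 (h '' U) (pushForward h U u.val) ∧
    MemH1 (h '' U) (pushForward h U (divJacobian h u.val))

/-- The bilinear form `∫_U ∇u · ∇ψ dx + a ∫_U u ψ dx` of the unperturbed operator. -/
def unperturbedForm (a : ℝ) (U : Set Plane) (u ψ : H1 U) : ℂ :=
  (∫ x in U, ∑ i, u.grad x i * ψ.grad x i) + (a : ℂ) * ∫ x in U, u.val x * ψ.val x

/-- `A` is the operator in `H⁻¹(U)` with domain `H¹(U)` that is defined by the form `B`: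
`⟨A u, ψ⟩ = B u ψ` for all `u, ψ ∈ H¹(U)`. -/
structure IsOperatorOfForm {U : Set Plane} (B : H1 U → H1 U → ℂ)
    (A : Hneg1 U →ₗ.[ℂ] Hneg1 U) : Prop where
  domain_eq : A.domain = LinearMap.range (H1.toHneg1 U)
  apply_eq : ∀ (u : H1 U) (hu : H1.toHneg1 U u ∈ A.domain) (ψ : H1 U),
    A ⟨H1.toHneg1 U u, hu⟩ ψ = B u ψ

/-- The bounded operator `R` is the inverse of `z - A`. -/
structure IsResolventAt {X : Type*} [NormedAddCommGroup X] [NormedSpace ℂ X]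
    (A : X →ₗ.[ℂ] X) (z : ℂ) (R : X →L[ℂ] X) : Prop where
  right_inv : ∀ x : X, ∃ hx : R x ∈ A.domain, z • R x - A ⟨R x, hx⟩ = x
  left_inv : ∀ x : A.domain, R (z • (x : X) - A x) = x

/-- Sectorial operators in the complex Banach space `X`: closed, densely defined, and for some
`θ ∈ (0, π/2)`, `M ≥ 1`, `b ∈ ℝ` every `z ≠ b` with `θ ≤ |arg (z - b)| ≤ π` is in the resolvent
set, with `‖(z - A)⁻¹‖ ≤ M / |z - b|`. -/
def IsSectorial {X : Type*} [NormedAddCommGroup X] [NormedSpace ℂ X]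
    (A : X →ₗ.[ℂ] X) : Prop :=
  A.IsClosed ∧ Dense (A.domain : Set X) ∧
    ∃ θ ∈ Ioo (0 : ℝ) (Real.pi / 2), ∃ M : ℝ, 1 ≤ M ∧ ∃ b : ℝ,
      ∀ z : ℂ, z ≠ (b : ℂ) → θ ≤ |Complex.arg (z - b)| → |Complex.arg (z - b)| ≤ Real.pi →
        ∃ R : X →L[ℂ] X, IsResolventAt A z R ∧ ‖R‖ ≤ M / ‖z - b‖

/-- The maps `h_ε(x₁, x₂) = (x₁, x₂ + x₂ ε sin(x₁ / ε^α))`. -/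
def hMap (α ε : ℝ) (x : Plane) : Plane :=
  !₂[x 0, x 1 + x 1 * ε * Real.sin (x 0 / ε ^ α)]

end

/-! The map `hMap α ε` has the form (x₁, x₂ c(x₁)) with c = 1 + ε sin(x₁/ε^α). Its Jacobian
determinant is c, and both |c - 1| ≤ ε and |c'| ≤ ε^(1-α) are at most η = ε^(1-α) when 0 < ε < 1.
The oscillation is fast, but its slope still tends to 0 because α < 1.

By the chain rule the pulled back gradient of u is (∂₁u - x₂(c'/c)∂₂u, ∂₂u/c)
(`IsWeakGradient.pushForward_stretch`). Inserting ψ/c in the second slot and multiplying by c gives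
∇u·∇ψ plus five products of u-derivatives with ψ or its derivatives, whose coefficients are O(η) on
the square (`pulledBack_integrand_stretch`, `coefficient_bounds`). Hence A_ε = A + D with ‖Du‖ ≤
20η‖u‖ from H¹ to H⁻¹ (`exists_perturbation`).

Testing against the conjugate of u shows that A is coercive with constant min(1, a), so ‖u‖ ≤
‖Au‖/min(1, a), and τ(ε) = 20 ε^(1-α)/min(1, a) works. Half of the coercivity survives the
perturbation once 20η ≤ min(1, a)/2. Sectoriality follows from coercivity alone: the values of the
form on (u, conj u) lie in a sector, and a Lax-Milgram argument inverts S - zj for z away from it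
(`isSectorial_operatorThrough`). -/

noncomputable section

/-! ### Coercive forms on a Hilbert space: inversion, sectoriality, density. -/

section CoerciveForms

variable {V : Type*} [NormedAddCommGroup V] [InnerProductSpace ℂ V]

lemma mul_norm_le_norm_of_apply (f : StrongDual ℂ V) {u v : V} (hv : ‖v‖ ≤ ‖u‖) {δ : ℝ}
    (h : δ * ‖u‖ ^ 2 ≤ ‖f v‖) : δ * ‖u‖ ≤ ‖f‖ := by
  have h1 : ‖f v‖ ≤ ‖f‖ * ‖u‖ :=
    (f.le_opNorm _).trans (mul_le_mul_of_nonneg_left hv (norm_nonneg _))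
  rcases (norm_nonneg u).eq_or_lt with h0 | h0
  · rw [← h0, mul_zero]; exact norm_nonneg _
  · exact le_of_mul_le_mul_right (by nlinarith) h0

variable [CompleteSpace V]

/-- The Lax-Milgram theorem for a bilinear form `⟨S u, v⟩` which is coercive with respect to a
norm-nonincreasing surjective map `σ` (for example a complex conjugation). -/
lemma exists_inverse_of_coercive (S : V →L[ℂ] StrongDual ℂ V) {σ : V → V}
    (hσσ : ∀ u, σ (σ u) = u) (hσ : ∀ u, ‖σ u‖ ≤ ‖u‖) {δ : ℝ} (hδ : 0 < δ)
    (h : ∀ u, δ * ‖u‖ ^ 2 ≤ ‖S u (σ u)‖) :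
    ∃ T : StrongDual ℂ V →L[ℂ] V, (∀ f, S (T f) = f) ∧ (∀ u, T (S u) = u) ∧
      ∀ f, ‖T f‖ ≤ δ⁻¹ * ‖f‖ := by
  have hb : ∀ u, ‖u‖ ≤ δ⁻¹ * ‖S u‖ := by
    intro u
    have h2 := mul_norm_le_norm_of_apply (S u) (hσ u) (h u)
    rw [inv_mul_eq_div, le_div_iff₀ hδ]
    linarith
  have hanti : AntilipschitzWith ⟨δ⁻¹, by positivity⟩ S :=
    ContinuousLinearMap.antilipschitz_of_bound S hb
  -- The range is closed because S is bounded below; it remains to see that it is dense, which is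
  -- checked in V through the Riesz isometry.
  have hcl : IsClosed (LinearMap.range S.toLinearMap : Set (StrongDual ℂ V)) :=
    hanti.isClosed_range S.uniformContinuous
  have hσn : ∀ u, ‖u‖ ≤ ‖σ u‖ := fun u => by simpa [hσσ] using hσ (σ u)
  let e := (InnerProductSpace.toDual ℂ V).symm
  let K : Submodule ℂ V := (LinearMap.range S.toLinearMap).map e.toLinearEquiv.toLinearMap
  have hKcl : IsClosed (K : Set V) := by
    have : (K : Set V) = e '' (LinearMap.range S.toLinearMap : Set (StrongDual ℂ V)) := rfl
    rw [this]
    exact e.toHomeomorph.isClosedMap _ hcl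
  have hKbot : Kᗮ = ⊥ := by
    rw [Submodule.eq_bot_iff]
    intro v hv
    -- Orthogonality to the range means in particular that S(σ v) vanishes at v = σ(σ v), so
    -- coercivity at σ v forces v = 0.
    have h1 := (Submodule.mem_orthogonal K v).1 hv (e (S (σ v))) ⟨S (σ v), ⟨σ v, rfl⟩, rfl⟩
    rw [InnerProductSpace.toDual_symm_apply] at h1
    have h2 := h (σ v)
    rw [hσσ, h1, norm_zero] at h2
    have h3 : ‖σ v‖ = 0 := by
      by_contra h4
      have : 0 < ‖σ v‖ := lt_of_le_of_ne (norm_nonneg _) (Ne.symm h4)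
      nlinarith [mul_pos hδ (pow_pos this 2)]
    exact norm_eq_zero.1 (le_antisymm ((hσn v).trans h3.le) (norm_nonneg _))
  have hKtop : K = ⊤ := by
    have : CompleteSpace K := hKcl.completeSpace_coe
    rw [← Submodule.orthogonal_orthogonal K, hKbot, Submodule.bot_orthogonal_eq_top]
  have hsurj : Function.Surjective S := by
    intro f
    have : e f ∈ K := by rw [hKtop]; trivial
    obtain ⟨g, ⟨u, rfl⟩, hg⟩ := this
    exact ⟨u, e.injective hg⟩
  let E := LinearEquiv.ofBijective S.toLinearMap ⟨hanti.injective, hsurj⟩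
  have hE : ∀ f, S (E.symm f) = f := fun f => E.apply_symm_apply f
  have hEb : ∀ f, ‖E.symm f‖ ≤ δ⁻¹ * ‖f‖ := fun f => by
    simpa only [hE] using hb (E.symm f)
  exact ⟨E.symm.toLinearMap.mkContinuous δ⁻¹ hEb, hE, fun u => E.symm_apply_apply u, hEb⟩

/-- Here z plays the value of a form with coercivity c and bound C, and w lies outside a wider
sector of half-angle arccos(c/(2C)). With k = c/(2C) and ‖w‖ ≤ ‖z - w‖ + Cs, comparing real parts
gives cs/2 ≤ (1 + k)‖z - w‖. The factor 2 in k leaves the room cs/2 between the two sectors. -/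
lemma sector_dist_lower_bound {c C : ℝ} (hc : 0 < c) (hcC : c ≤ C) {z w : ℂ} {s : ℝ}
    (hs : 0 ≤ s) (hz : c * s ≤ z.re) (hzC : ‖z‖ ≤ C * s)
    (hw : w.re ≤ c / (2 * C) * ‖w‖) : c ^ 2 / (4 * C) * s ≤ ‖z - w‖ := by
  have hC : 0 < C := hc.trans_le hcC
  have h1 : z.re - w.re ≤ ‖z - w‖ := by
    simpa using Complex.re_le_norm (z - w)
  have h2 : ‖w‖ ≤ ‖z - w‖ + ‖z‖ := by
    have := norm_sub_le z (z - w)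
    rw [sub_sub_cancel] at this
    linarith
  set k := c / (2 * C) with hk
  have hk0 : 0 < k := by positivity
  have hk1 : k ≤ 1 / 2 := by rw [hk, div_le_iff₀ (by positivity)]; linarith
  have hkC : k * (C * s) = c * s / 2 := by rw [hk]; field_simp
  have h3 : k * ‖w‖ ≤ k * ‖z - w‖ + c * s / 2 := by
    rw [← hkC]; nlinarith
  have h4 : c * s / 2 ≤ 3 / 2 * ‖z - w‖ := by nlinarith [norm_nonneg (z - w)]
  have h5 : c ^ 2 / (4 * C) ≤ c / 4 := by
    rw [div_le_div_iff₀ (by positivity) (by positivity)]; nlinarith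
  nlinarith [mul_le_mul_of_nonneg_right h5 hs]

/-- The operator `S ∘ j⁻¹` with domain the range of `j`. -/
def operatorThrough {X W : Type*} [AddCommGroup X] [Module ℂ X] [AddCommGroup W] [Module ℂ W]
    (j S : W →ₗ[ℂ] X) (hj : Function.Injective j) : X →ₗ.[ℂ] X where
  domain := LinearMap.range j
  toFun := S ∘ₗ (LinearEquiv.ofInjective j hj).symm.toLinearMap

lemma operatorThrough_apply {X W : Type*} [AddCommGroup X] [Module ℂ X] [AddCommGroup W]
    [Module ℂ W] (j S : W →ₗ[ℂ] X) (hj : Function.Injective j) (u : W)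
    (hu : j u ∈ (operatorThrough j S hj).domain) : operatorThrough j S hj ⟨j u, hu⟩ = S u := by
  change S ((LinearEquiv.ofInjective j hj).symm _) = S u
  exact congrArg S ((LinearEquiv.ofInjective j hj).symm_apply_apply u)

/-- An operator given by a bounded coercive form on `V`, with `V` densely included in its dual, is
sectorial in the dual space. -/
theorem isSectorial_operatorThrough (j S : V →L[ℂ] StrongDual ℂ V)
    (hj : Function.Injective j.toLinearMap) (hd : DenseRange j) {σ : V → V}
    (hσσ : ∀ u, σ (σ u) = u) (hσ : ∀ u, ‖σ u‖ ≤ ‖u‖)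
    (hpos : ∀ u, ∃ m : ℝ, 0 ≤ m ∧ j u (σ u) = m) {c : ℝ} (hc : 0 < c)
    (hco : ∀ u, c * ‖u‖ ^ 2 ≤ (S u (σ u)).re) :
    IsSectorial (operatorThrough j.toLinearMap S.toLinearMap hj) := by
  obtain ⟨C, hcC, hbd⟩ : ∃ C, c ≤ C ∧ ∀ u, ‖S u‖ ≤ C * ‖u‖ :=
    ⟨max c ‖S‖, le_max_left _ _, fun u => (S.le_opNorm u).trans
      (mul_le_mul_of_nonneg_right (le_max_right _ _) (norm_nonneg _))⟩
  have hC : 0 < C := hc.trans_le hcC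
  have hbd2 : ∀ u, ‖S u (σ u)‖ ≤ C * ‖u‖ ^ 2 := fun u => by
    refine ((S u).le_opNorm _).trans ?_
    have := mul_le_mul (hbd u) (hσ u) (norm_nonneg _) (by positivity)
    nlinarith
  have hap : ∀ u hu, operatorThrough j.toLinearMap S.toLinearMap hj ⟨j u, hu⟩ = S u :=
    fun u hu => operatorThrough_apply j.toLinearMap S.toLinearMap hj u hu
  refine ⟨?_, ?_, ?_⟩
  · obtain ⟨T, hT1, hT2, -⟩ := exists_inverse_of_coercive S hσσ hσ hc
      (fun u => (hco u).trans (Complex.re_le_norm _))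
    -- With T the bounded inverse of S, the graph is the closed set x = j(T y).
    have : ((operatorThrough j.toLinearMap S.toLinearMap hj).graph :
        Set (StrongDual ℂ V × StrongDual ℂ V)) = {p | p.1 = j (T p.2)} := by
      ext ⟨x, y⟩
      simp only [SetLike.mem_coe, LinearPMap.mem_graph_iff, mem_ofPred_eq]
      constructor
      · rintro ⟨⟨_, ⟨u, rfl⟩⟩, rfl, rfl⟩
        exact congrArg j ((hT2 u).symm.trans (congrArg T (hap u ⟨u, rfl⟩).symm))
      · rintro rfl
        exact ⟨⟨j (T y), ⟨T y, rfl⟩⟩, rfl, (hap _ _).trans (hT1 y)⟩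
    rw [LinearPMap.IsClosed, this]
    exact isClosed_eq continuous_fst (by fun_prop)
  · exact hd
  · set k := c / (2 * C) with hk
    have hk0 : 0 < k := by positivity
    have hk1 : k < 1 := by rw [hk, div_lt_one (by positivity)]; linarith
    set δ := c ^ 2 / (4 * C) with hδ
    have hδ0 : 0 < δ := by positivity
    -- The sector has vertex 0, and its half-angle is chosen so that |arg z| ≥ θ reads Re z ≤ k‖z‖.
    -- The constant M comes from the identity zjT = ST - 1 below.
    refine ⟨Real.arccos k, ⟨Real.arccos_pos.2 hk1, Real.arccos_lt_pi_div_two.2 hk0⟩,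
      1 + C * δ⁻¹, by have : 0 < C * δ⁻¹ := by positivity
                      linarith, 0, ?_⟩
    intro z hz hz1 hz2
    rw [Complex.ofReal_zero] at hz
    rw [Complex.ofReal_zero, sub_zero] at hz1 hz2 ⊢
    have hzre : z.re ≤ k * ‖z‖ := by
      have h1 : Real.cos |z.arg| ≤ Real.cos (Real.arccos k) :=
        Real.cos_le_cos_of_nonneg_of_le_pi (Real.arccos_nonneg _) hz2 hz1
      rw [Real.cos_arccos (by linarith) hk1.le, Real.cos_abs] at h1
      rw [← Complex.norm_mul_cos_arg z, mul_comm]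
      exact mul_le_mul_of_nonneg_right h1 (norm_nonneg _)
    -- Since j u (σ u) is a nonnegative real m, the point zm satisfies the same condition as z. Thus
    -- S - zj is coercive with a constant δ independent of z.
    obtain ⟨T, hT1, hT2, hT3⟩ := exists_inverse_of_coercive (S - z • j) hσσ hσ hδ0 (by
      intro u
      obtain ⟨m, hm, hjm⟩ := hpos u
      have := sector_dist_lower_bound hc hcC (z := S u (σ u)) (w := z * m) (sq_nonneg ‖u‖)
        (hco u) (hbd2 u) (by
          rw [Complex.re_mul_ofReal, norm_mul, Complex.norm_real, Real.norm_of_nonneg hm,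
            ← mul_assoc]
          exact mul_le_mul_of_nonneg_right hzre hm)
      simpa [hjm] using this)
    -- This identity supplies the decay 1/‖z‖: the right side is bounded by (C/δ + 1)‖f‖ uniformly
    -- in z.
    have hT1' : ∀ f, z • j (T f) = S (T f) - f := fun f => by
      have := hT1 f
      simp only [sub_apply, smul_apply] at this
      nth_rewrite 3 [← this]
      abel
    -- The sign comes from z - S j⁻¹ = -(S - zj) j⁻¹.
    refine ⟨-(j.comp T), ⟨fun f => ?_, ?_⟩, ?_⟩
    · have h0 : (-(j.comp T)) f ∈ (operatorThrough j.toLinearMap S.toLinearMap hj).domain :=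
        ⟨-T f, by simp⟩
      refine ⟨h0, ?_⟩
      have : ∀ hx, operatorThrough j.toLinearMap S.toLinearMap hj ⟨(-(j.comp T)) f, hx⟩
          = -S (T f) := by
        intro hx
        have h1 : (-(j.comp T)) f = j (-T f) := by simp
        simp only [h1]
        rw [hap, map_neg]
      erw [this]
      have h2 := hT1' f
      simp only [neg_apply, ContinuousLinearMap.comp_apply, smul_neg, h2]
      abel
    · rintro ⟨_, ⟨u, rfl⟩⟩
      have := hap u ⟨u, rfl⟩
      change (-(j.comp T)) (z • j u - _) = j u
      erw [this]
      have h3 : z • j u - S u = -((S - z • j) u) := by simp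
      rw [h3, map_neg, neg_apply, ContinuousLinearMap.comp_apply, hT2, neg_neg]
    · refine ContinuousLinearMap.opNorm_le_bound _ (by positivity) fun f => ?_
      have hz0 : 0 < ‖z‖ := norm_pos_iff.2 hz
      rw [div_mul_eq_mul_div, le_div_iff₀ hz0, neg_apply, norm_neg,
        ContinuousLinearMap.comp_apply, mul_comm, ← norm_smul, hT1']
      calc ‖S (T f) - f‖ ≤ ‖S (T f)‖ + ‖f‖ := norm_sub_le _ _
        _ ≤ C * (δ⁻¹ * ‖f‖) + ‖f‖ := by
          have := (hbd (T f)).trans (mul_le_mul_of_nonneg_left (hT3 f) hC.le)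
          linarith
        _ = _ := by ring

/-- A vector v orthogonal to the Riesz representatives of the range is annihilated by j(σ v), hence
is zero by the hypothesis. -/
lemma denseRange_of_positive (j : V →L[ℂ] StrongDual ℂ V) {σ : V → V}
    (hpos : ∀ u, j (σ u) u = 0 → u = 0) : DenseRange j := by
  let e := (InnerProductSpace.toDual ℂ V).symm
  let K : Submodule ℂ V := (LinearMap.range j.toLinearMap).map e.toLinearEquiv.toLinearMap
  have hKbot : Kᗮ = ⊥ := by
    rw [Submodule.eq_bot_iff]
    intro v hv
    have h1 := (Submodule.mem_orthogonal K v).1 hv (e (j (σ v))) ⟨j (σ v), ⟨σ v, rfl⟩, rfl⟩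
    rw [InnerProductSpace.toDual_symm_apply] at h1
    exact hpos v h1
  have hKd : Dense (K : Set V) :=
    (Submodule.dense_iff_topologicalClosure_eq_top).2
      ((Submodule.topologicalClosure_eq_top_iff).2 hKbot)
  have : (range j : Set (StrongDual ℂ V)) = e.symm '' (K : Set V) := by
    have h2 : (K : Set V) = e '' range j := rfl
    rw [h2, ← image_comp]
    simp
  rw [DenseRange, this]
  exact e.symm.surjective.denseRange.dense_image e.symm.continuous hKd

end CoerciveForms

/-! ### Weak gradients, complex conjugation and completeness of H¹. -/

section WeakGradient

variable {U : Set Plane}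

lemma IsWeakGradient.congr {f f' : Plane → ℂ} {g g' : Plane → EuclideanSpace ℂ (Fin 2)}
    (h : IsWeakGradient U f g) (hf : f =ᵐ[volume.restrict U] f')
    (hg : g =ᵐ[volume.restrict U] g') : IsWeakGradient U f' g' := by
  intro φ hφ hc hs i
  have h1 : ∫ x in U, (partialDeriv i φ x : ℂ) * f' x
      = ∫ x in U, (partialDeriv i φ x : ℂ) * f x :=
    integral_congr_ae (hf.mono fun x hx => by simp only [hx])
  have h2 : ∫ x in U, (φ x : ℂ) * g' x i = ∫ x in U, (φ x : ℂ) * g x i :=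
    integral_congr_ae (hg.mono fun x hx => by simp only [hx])
  rw [h1, h2, h φ hφ hc hs i]

/-- The coordinates of g - g' integrate to zero against every test function, so the fundamental
lemma of the calculus of variations applies. -/
lemma IsWeakGradient.ae_unique (hU : IsOpen U) {f : Plane → ℂ}
    {g g' : Plane → EuclideanSpace ℂ (Fin 2)} (h : IsWeakGradient U f g)
    (h' : IsWeakGradient U f g') (hg : MemLp g 2 (volume.restrict U))
    (hg' : MemLp g' 2 (volume.restrict U)) : g =ᵐ[volume.restrict U] g' := by
  have key : ∀ i, ∀ᵐ x ∂(volume.restrict U), g x i = g' x i := by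
    intro i
    have hm := (coord_memLp hg i).sub (coord_memLp hg' i)
    have hloc : LocallyIntegrableOn ((fun x => g x i) - fun x => g' x i) U volume :=
      locallyIntegrableOn_of_locallyIntegrable_restrict (hm.locallyIntegrable (by norm_num))
    have := hU.ae_eq_zero_of_integral_contDiff_smul_eq_zero hloc (by
      intro φ hφ hc hs
      rw [← setIntegral_eq_integral_of_forall_compl_eq_zero (s := U) (fun x hx => by
        rw [image_eq_zero_of_notMem_tsupport (fun hx' => hx (hs hx')), zero_smul])]
      have m2 := testFunction_memLp hφ hc U
      have i1 : Integrable (fun x => (φ x : ℂ) * g x i) (volume.restrict U) :=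
        m2.integrable_mul (coord_memLp hg i)
      have i2 : Integrable (fun x => (φ x : ℂ) * g' x i) (volume.restrict U) :=
        m2.integrable_mul (coord_memLp hg' i)
      have e : ∀ x, φ x • ((fun x => g x i) - fun x => g' x i) x
          = (φ x : ℂ) * g x i - (φ x : ℂ) * g' x i := fun x => by
        simp [mul_sub]
      simp_rw [e]
      rw [integral_sub i1 i2, sub_eq_zero]
      exact neg_injective ((h φ hφ hc hs i).symm.trans (h' φ hφ hc hs i)))
    rw [ae_restrict_iff' hU.measurableSet]
    filter_upwards [this] with x hx hxU
    exact sub_eq_zero.1 (hx hxU)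
  filter_upwards [ae_all_iff.2 key] with x hx
  exact PiLp.ext hx

/-- The element of `H¹(U)` given by an `L²` function with an `L²` weak gradient. -/
def H1.ofWeakGradient {f : Plane → ℂ} {g : Plane → EuclideanSpace ℂ (Fin 2)}
    (hf : MemLp f 2 (volume.restrict U)) (hg : MemLp g 2 (volume.restrict U))
    (h : IsWeakGradient U f g) : H1 U :=
  ⟨WithLp.toLp 2 (hf.toLp f, hg.toLp g), h.congr hf.coeFn_toLp.symm hg.coeFn_toLp.symm⟩

lemma H1.val_ofWeakGradient {f : Plane → ℂ} {g : Plane → EuclideanSpace ℂ (Fin 2)}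
    (hf : MemLp f 2 (volume.restrict U)) (hg : MemLp g 2 (volume.restrict U))
    (h : IsWeakGradient U f g) :
    (H1.ofWeakGradient hf hg h).val =ᵐ[volume.restrict U] f := hf.coeFn_toLp

lemma H1.grad_ofWeakGradient {f : Plane → ℂ} {g : Plane → EuclideanSpace ℂ (Fin 2)}
    (hf : MemLp f 2 (volume.restrict U)) (hg : MemLp g 2 (volume.restrict U))
    (h : IsWeakGradient U f g) :
    (H1.ofWeakGradient hf hg h).grad =ᵐ[volume.restrict U] g := hg.coeFn_toLp

lemma H1.isWeakGradient (u : H1 U) : IsWeakGradient U u.val u.grad := u.2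

lemma H1.val_memLp (u : H1 U) : MemLp u.val 2 (volume.restrict U) := Lp.memLp _

lemma H1.grad_memLp (u : H1 U) : MemLp u.grad 2 (volume.restrict U) := Lp.memLp _

lemma H1.ext_ae {u v : H1 U} (h1 : u.val =ᵐ[volume.restrict U] v.val)
    (h2 : u.grad =ᵐ[volume.restrict U] v.grad) : u = v :=
  Subtype.ext (WithLp.ofLp_injective 2 (Prod.ext (Lp.ext h1) (Lp.ext h2)))

lemma H1.ext_val (hU : IsOpen U) {u v : H1 U} (h : u.val =ᵐ[volume.restrict U] v.val) : u = v :=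
  H1.ext_ae h ((u.isWeakGradient.congr h (ae_eq_refl _)).ae_unique hU v.isWeakGradient
    u.grad_memLp v.grad_memLp)

lemma memH1_of_isWeakGradient {f : Plane → ℂ} {g : Plane → EuclideanSpace ℂ (Fin 2)}
    (hf : MemLp f 2 (volume.restrict U)) (hg : MemLp g 2 (volume.restrict U))
    (h : IsWeakGradient U f g) : MemH1 U f :=
  ⟨H1.ofWeakGradient hf hg h, H1.val_ofWeakGradient hf hg h⟩

lemma weakGradient_ae_eq (hU : IsOpen U) {f : Plane → ℂ} {g : Plane → EuclideanSpace ℂ (Fin 2)}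
    (hf : MemLp f 2 (volume.restrict U)) (hg : MemLp g 2 (volume.restrict U))
    (h : IsWeakGradient U f g) : weakGradient U f =ᵐ[volume.restrict U] g := by
  have hm := memH1_of_isWeakGradient hf hg h
  rw [weakGradient, dif_pos hm]
  exact (hm.choose.isWeakGradient.congr hm.choose_spec (ae_eq_refl _)).ae_unique hU h
    hm.choose.grad_memLp hg

lemma conj_memLp {f : Plane → ℂ} (hf : MemLp f 2 (volume.restrict U)) :
    MemLp (fun x => (starRingEnd ℂ) (f x)) 2 (volume.restrict U) :=
  hf.of_le (Complex.continuous_conj.comp_aestronglyMeasurable hf.1) (by simp)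

/-- The conjugate of a vector of `ℂ²`. -/
def conjVec (v : EuclideanSpace ℂ (Fin 2)) : EuclideanSpace ℂ (Fin 2) :=
  WithLp.toLp 2 fun i => (starRingEnd ℂ) (v i)

lemma norm_conjVec (v : EuclideanSpace ℂ (Fin 2)) : ‖conjVec v‖ = ‖v‖ := by
  simp [EuclideanSpace.norm_eq, conjVec]

lemma conjVec_memLp {g : Plane → EuclideanSpace ℂ (Fin 2)}
    (hg : MemLp g 2 (volume.restrict U)) :
    MemLp (fun x => conjVec (g x)) 2 (volume.restrict U) := by
  have hc : Continuous conjVec := by unfold conjVec; fun_prop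
  exact hg.of_le (hc.comp_aestronglyMeasurable hg.1) (by simp [norm_conjVec])

/-- Test functions are real, so conjugating the defining identity leaves them unchanged. -/
lemma IsWeakGradient.conj {f : Plane → ℂ} {g : Plane → EuclideanSpace ℂ (Fin 2)}
    (h : IsWeakGradient U f g) :
    IsWeakGradient U (fun x => (starRingEnd ℂ) (f x)) (fun x => conjVec (g x)) := by
  intro φ hφ hc hs i
  have := congrArg (starRingEnd ℂ) (h φ hφ hc hs i)
  rw [map_neg, ← integral_conj, ← integral_conj] at this
  simpa [conjVec] using this

/-- The complex conjugate of an element of `H¹(U)`. -/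
def H1.conj (u : H1 U) : H1 U :=
  H1.ofWeakGradient (conj_memLp u.val_memLp) (conjVec_memLp u.grad_memLp) u.isWeakGradient.conj

lemma H1.val_conj (u : H1 U) :
    u.conj.val =ᵐ[volume.restrict U] fun x => (starRingEnd ℂ) (u.val x) :=
  H1.val_ofWeakGradient _ _ _

lemma H1.grad_conj (u : H1 U) :
    u.conj.grad =ᵐ[volume.restrict U] fun x => conjVec (u.grad x) :=
  H1.grad_ofWeakGradient _ _ _

lemma H1.conj_conj (u : H1 U) : u.conj.conj = u := by
  refine H1.ext_ae ?_ ?_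
  · filter_upwards [u.val_conj, u.conj.val_conj] with x h1 h2
    simp [h2, h1]
  · filter_upwards [u.grad_conj, u.conj.grad_conj] with x h1 h2
    simp [h2, h1, conjVec]

lemma H1.norm_sq (u : H1 U) : ‖u‖ ^ 2 = ‖u.1.fst‖ ^ 2 + ‖u.1.snd‖ ^ 2 :=
  WithLp.prod_norm_sq_eq_of_L2 u.1

lemma H1.norm_conj (u : H1 U) : ‖u.conj‖ = ‖u‖ := by
  have h1 : ‖u.conj.1.fst‖ = ‖u.1.fst‖ := by
    rw [Lp.norm_def, Lp.norm_def]
    congr 1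
    exact eLpNorm_congr_norm_ae (u.val_conj.mono fun x hx => by
      change ‖u.conj.val x‖ = ‖u.val x‖
      simp [hx])
  have h2 : ‖u.conj.1.snd‖ = ‖u.1.snd‖ := by
    rw [Lp.norm_def, Lp.norm_def]
    congr 1
    exact eLpNorm_congr_norm_ae (u.grad_conj.mono fun x hx => by
      change ‖u.conj.grad x‖ = ‖u.grad x‖
      rw [hx, norm_conjVec])
  rw [← sq_eq_sq₀ (norm_nonneg _) (norm_nonneg _), H1.norm_sq, H1.norm_sq, h1, h2]

/-- The coordinates of an `L²` vector field. -/
def coordL (U : Set Plane) (i : Fin 2) :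
    Lp (EuclideanSpace ℂ (Fin 2)) 2 (volume.restrict U) →L[ℂ] Lp ℂ 2 (volume.restrict U) :=
  (EuclideanSpace.proj (𝕜 := ℂ) i).compLpL 2 (volume.restrict U)

lemma coordL_ae_eq (i : Fin 2) (g : Lp (EuclideanSpace ℂ (Fin 2)) 2 (volume.restrict U)) :
    coordL U i g =ᵐ[volume.restrict U] fun x => g x i :=
  ContinuousLinearMap.coeFn_compLpL _ g

lemma norm_coordL_le (i : Fin 2) (g : Lp (EuclideanSpace ℂ (Fin 2)) 2 (volume.restrict U)) :
    ‖coordL U i g‖ ≤ ‖g‖ := by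
  refine Lp.norm_le_norm_of_ae_le ?_
  filter_upwards [coordL_ae_eq i g] with x hx
  rw [hx]
  exact PiLp.norm_apply_le _ _

/-- For each test function and index, both sides of the weak gradient identity are continuous on L²
× L², so each condition is closed. This makes H¹ complete, as the Lax-Milgram argument requires. -/
lemma isClosed_sobolevH1 (U : Set Plane) : IsClosed (sobolevH1 U : Set (WithLp 2
    (Lp ℂ 2 (volume.restrict U) × Lp (EuclideanSpace ℂ (Fin 2)) 2 (volume.restrict U)))) := by
  have : (sobolevH1 U : Set (WithLp 2 (Lp ℂ 2 (volume.restrict U) ×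
      Lp (EuclideanSpace ℂ (Fin 2)) 2 (volume.restrict U)))) =
      ⋂ (φ : Plane → ℝ) (hφ : ContDiff ℝ ∞ φ) (hc : HasCompactSupport φ) (_ : tsupport φ ⊆ U)
        (i : Fin 2), {p | (ContinuousLinearMap.mul ℂ ℂ).lpPairing (volume.restrict U) 2 2
          ((partialDeriv_memLp hφ hc U i).toLp _) p.fst =
          - (ContinuousLinearMap.mul ℂ ℂ).lpPairing (volume.restrict U) 2 2
          ((testFunction_memLp hφ hc U).toLp _) (coordL U i p.snd)} := by
    ext p
    simp only [mem_iInter, mem_ofPred_eq, ContinuousLinearMap.lpPairing_eq_integral]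
    refine forall_congr' fun φ => forall_congr' fun hφ => forall_congr' fun hc =>
      forall_congr' fun hs => forall_congr' fun i => ?_
    have e1 : ∫ x in U, (ContinuousLinearMap.mul ℂ ℂ)
        ((partialDeriv_memLp hφ hc U i).toLp _ x) (p.fst x) =
        ∫ x in U, (partialDeriv i φ x : ℂ) * p.fst x :=
      integral_congr_ae (((partialDeriv_memLp hφ hc U i).coeFn_toLp).mono fun x hx => by
        simp [hx])
    have e2 : ∫ x in U, (ContinuousLinearMap.mul ℂ ℂ)
        ((testFunction_memLp hφ hc U).toLp _ x) (coordL U i p.snd x) =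
        ∫ x in U, (φ x : ℂ) * p.snd x i := by
      refine integral_congr_ae ?_
      filter_upwards [(testFunction_memLp hφ hc U).coeFn_toLp, coordL_ae_eq i p.snd] with x h1 h2
      simp [h1, h2]
    rw [e1, e2]
  rw [this]
  refine isClosed_iInter fun φ => isClosed_iInter fun hφ => isClosed_iInter fun hc =>
    isClosed_iInter fun _ => isClosed_iInter fun i => isClosed_eq ?_ ?_
  · exact (ContinuousLinearMap.continuous _).comp (WithLp.fstL 2 ℂ _ _).continuous
  · exact ((ContinuousLinearMap.continuous _).comp
      ((coordL U i).continuous.comp (WithLp.sndL 2 ℂ _ _).continuous)).neg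

instance (U : Set Plane) : CompleteSpace (H1 U) := (isClosed_sobolevH1 U).completeSpace_coe

end WeakGradient

/-! ### Bounded bilinear forms on H¹ and the unperturbed operator. -/

section Forms

variable {U : Set Plane}

/-- The weak partial derivative as a map `H¹(U) → L²(U)`. -/
def H1.partialL (U : Set Plane) (i : Fin 2) : H1 U →L[ℂ] Lp ℂ 2 (volume.restrict U) :=
  (coordL U i).comp ((WithLp.sndL 2 ℂ (Lp ℂ 2 (volume.restrict U))
    (Lp (EuclideanSpace ℂ (Fin 2)) 2 (volume.restrict U))).comp (sobolevH1 U).subtypeL)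

lemma H1.partialL_ae_eq (i : Fin 2) (u : H1 U) :
    H1.partialL U i u =ᵐ[volume.restrict U] fun x => u.grad x i := coordL_ae_eq i u.1.snd

lemma H1.norm_partialL_le (i : Fin 2) (u : H1 U) : ‖H1.partialL U i u‖ ≤ ‖u‖ := by
  refine (norm_coordL_le i u.1.snd).trans ?_
  rw [← sq_le_sq₀ (norm_nonneg _) (norm_nonneg _), H1.norm_sq]
  exact le_add_of_nonneg_left (sq_nonneg _)

lemma H1.norm_toL2_le (u : H1 U) : ‖H1.toL2 U u‖ ≤ ‖u‖ := by
  change ‖u.1.fst‖ ≤ ‖u‖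
  rw [← sq_le_sq₀ (norm_nonneg _) (norm_nonneg _), H1.norm_sq]
  exact le_add_of_nonneg_right (sq_nonneg _)

variable {m : Plane → ℂ} {K : ℝ}

lemma integrable_weighted (hm : Continuous m) (hK : ∀ᵐ x ∂(volume.restrict U), ‖m x‖ ≤ K)
    (f g : Lp ℂ 2 (volume.restrict U)) :
    Integrable (fun x => m x * (f x * g x)) (volume.restrict U) :=
  ((Lp.memLp f).integrable_mul (Lp.memLp g)).bdd_mul hm.aestronglyMeasurable hK

/-- Cauchy-Schwarz, obtained by viewing the product of f and g as an element of L¹. -/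
lemma norm_integral_weighted_le (hK0 : 0 ≤ K) (hK : ∀ᵐ x ∂(volume.restrict U), ‖m x‖ ≤ K)
    (f g : Lp ℂ 2 (volume.restrict U)) :
    ‖∫ x in U, m x * (f x * g x)‖ ≤ K * (‖f‖ * ‖g‖) := by
  have h2 : ∫ x in U, ‖f x‖ * ‖g x‖ ≤ ‖f‖ * ‖g‖ := by
    let h : Lp ℂ 1 (volume.restrict U) := (ContinuousLinearMap.mul ℂ ℂ).holder 1 f g
    have h3 : ‖h‖ = ∫ x in U, ‖f x‖ * ‖g x‖ := by
      rw [L1.norm_eq_integral_norm]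
      refine integral_congr_ae (((ContinuousLinearMap.mul ℂ ℂ).coeFn_holder (r := 1) f g).mono
        fun x hx => ?_)
      simp only [h, hx, ContinuousLinearMap.mul_apply', norm_mul]
    rw [← h3]
    refine ((ContinuousLinearMap.mul ℂ ℂ).norm_holder_apply_apply_le (r := 1) f g).trans ?_
    rw [ContinuousLinearMap.opNorm_mul, one_mul]
  have hint2 : Integrable (fun x => ‖f x‖ * ‖g x‖) (volume.restrict U) :=
    (Lp.memLp f).norm.integrable_mul (Lp.memLp g).norm
  refine (norm_integral_le_of_norm_le (hint2.const_mul K) ?_).trans ?_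
  · filter_upwards [hK] with x hx
    rw [norm_mul, norm_mul]
    exact mul_le_mul_of_nonneg_right hx (by positivity)
  · rw [integral_const_mul]
    exact mul_le_mul_of_nonneg_left h2 hK0

/-- The bilinear form `∫ m f g` on `L²` with a bounded weight `m`. -/
def weightedPairing (hm : Continuous m) (hK0 : 0 ≤ K)
    (hK : ∀ᵐ x ∂(volume.restrict U), ‖m x‖ ≤ K) :
    Lp ℂ 2 (volume.restrict U) →L[ℂ] Lp ℂ 2 (volume.restrict U) →L[ℂ] ℂ :=
  LinearMap.mkContinuous₂ (
    LinearMap.mk₂ ℂ (fun f g => ∫ x in U, m x * (f x * g x))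
      (fun f f' g => by
        rw [← integral_add (integrable_weighted hm hK f g) (integrable_weighted hm hK f' g)]
        refine integral_congr_ae ((Lp.coeFn_add f f').mono fun x hx => ?_)
        simp only [hx, Pi.add_apply]
        ring)
      (fun c f g => by
        rw [smul_eq_mul, ← integral_const_mul]
        refine integral_congr_ae ((Lp.coeFn_smul c f).mono fun x hx => ?_)
        simp only [hx, Pi.smul_apply, smul_eq_mul]
        ring)
      (fun f g g' => by
        rw [← integral_add (integrable_weighted hm hK f g) (integrable_weighted hm hK f g')]
        refine integral_congr_ae ((Lp.coeFn_add g g').mono fun x hx => ?_)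
        simp only [hx, Pi.add_apply]
        ring)
      (fun c f g => by
        rw [smul_eq_mul, ← integral_const_mul]
        refine integral_congr_ae ((Lp.coeFn_smul c g).mono fun x hx => ?_)
        simp only [hx, Pi.smul_apply, smul_eq_mul]
        ring)) K fun f g =>
      (norm_integral_weighted_le hK0 hK f g).trans_eq (mul_assoc _ _ _).symm

/-- The inclusion of `H¹(U)` in its dual as a bounded operator. -/
def H1.toHneg1L (U : Set Plane) : H1 U →L[ℂ] Hneg1 U :=
  ((ContinuousLinearMap.mul ℂ ℂ).lpPairing (volume.restrict U) 2 2).bilinearComp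
    (H1.toL2 U) (H1.toL2 U)

lemma H1.toHneg1L_apply (u ψ : H1 U) :
    H1.toHneg1L U u ψ = ∫ x in U, u.val x * ψ.val x := H1.toHneg1_apply u ψ

lemma integral_norm_sq_Lp {E : Type*} [NormedAddCommGroup E] [InnerProductSpace ℂ E]
    {μ : Measure Plane} (f : Lp E 2 μ) : ∫ x, ((‖f x‖ ^ 2 : ℝ) : ℂ) ∂μ = ((‖f‖ ^ 2 : ℝ) : ℂ) := by
  have h := L2.inner_def (𝕜 := ℂ) f f
  simp only [inner_self_eq_norm_sq_to_K] at h
  simpa using h.symm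

/-- The pairing carries no conjugation, so positivity appears only against the conjugate. This is
the role of σ in the abstract results. -/
lemma H1.toHneg1L_conj (u : H1 U) :
    H1.toHneg1L U u u.conj = ((‖H1.toL2 U u‖ ^ 2 : ℝ) : ℂ) := by
  rw [H1.toHneg1L_apply, ← integral_norm_sq_Lp]
  refine integral_congr_ae (u.val_conj.mono fun x hx => ?_)
  change u.val x * u.conj.val x = ((‖u.val x‖ ^ 2 : ℝ) : ℂ)
  rw [hx, Complex.mul_conj, Complex.normSq_eq_norm_sq]

lemma H1.toL2_eq_zero (hU : IsOpen U) {u : H1 U} (h : H1.toL2 U u = 0) : u = 0 := by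
  refine H1.ext_val hU ?_
  have h0 : H1.toL2 U (0 : H1 U) = 0 := map_zero _
  have h1 : u.1.fst = (0 : H1 U).1.fst := h.trans h0.symm
  change (u.1.fst : Plane → ℂ) =ᵐ[_] (0 : H1 U).1.fst
  rw [h1]

lemma H1.eq_zero_of_toHneg1L_conj (hU : IsOpen U) {u : H1 U}
    (h : H1.toHneg1L U u u.conj = 0) : u = 0 := by
  rw [H1.toHneg1L_conj, Complex.ofReal_eq_zero, sq_eq_zero_iff, norm_eq_zero] at h
  exact H1.toL2_eq_zero hU h

lemma H1.toHneg1_injective (hU : IsOpen U) : Function.Injective (H1.toHneg1 U) := by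
  rw [injective_iff_map_eq_zero]
  intro u hu
  refine H1.eq_zero_of_toHneg1L_conj hU ?_
  change H1.toHneg1 U u u.conj = 0
  rw [hu]
  rfl

lemma H1.toHneg1L_comm (u v : H1 U) : H1.toHneg1L U u v = H1.toHneg1L U v u := by
  simp only [H1.toHneg1L_apply, mul_comm]

lemma H1.denseRange_toHneg1L (hU : IsOpen U) : DenseRange (H1.toHneg1L U) :=
  denseRange_of_positive _ (σ := H1.conj) fun _ hu =>
    H1.eq_zero_of_toHneg1L_conj hU ((H1.toHneg1L_comm _ _).trans hu)

/-- The bounded operator `H¹(U) → H⁻¹(U)` of the form `∫ ∇u · ∇ψ + a ∫ u ψ`. -/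
def unperturbedL (a : ℝ) (U : Set Plane) : H1 U →L[ℂ] Hneg1 U :=
  (∑ i, ((ContinuousLinearMap.mul ℂ ℂ).lpPairing (volume.restrict U) 2 2).bilinearComp
    (H1.partialL U i) (H1.partialL U i)) + (a : ℂ) • H1.toHneg1L U

lemma H1.integrable_grad_mul (u ψ : H1 U) (i j : Fin 2) :
    Integrable (fun x => u.grad x i * ψ.grad x j) (volume.restrict U) :=
  (coord_memLp u.grad_memLp i).integrable_mul (coord_memLp ψ.grad_memLp j)

lemma unperturbedL_apply (a : ℝ) (u ψ : H1 U) :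
    unperturbedL a U u ψ = unperturbedForm a U u ψ := by
  rw [unperturbedForm, integral_finsetSum _ fun i _ => u.integrable_grad_mul ψ i i]
  simp only [unperturbedL, add_apply, smul_apply, smul_eq_mul, H1.toHneg1L_apply,
    sum_apply]
  congr 1
  refine Finset.sum_congr rfl fun i _ => ?_
  rw [ContinuousLinearMap.bilinearComp_apply, ContinuousLinearMap.lpPairing_eq_integral]
  refine integral_congr_ae ?_
  filter_upwards [u.partialL_ae_eq i, ψ.partialL_ae_eq i] with x h1 h2
  simp [h1, h2]

lemma unperturbedForm_conj (a : ℝ) (u : H1 U) :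
    unperturbedForm a U u u.conj = ((‖u.1.snd‖ ^ 2 + a * ‖u.1.fst‖ ^ 2 : ℝ) : ℂ) := by
  rw [unperturbedForm, ← H1.toHneg1L_apply, H1.toHneg1L_conj]
  push_cast
  congr 1
  have := integral_norm_sq_Lp u.1.snd
  push_cast at this
  rw [← this]
  refine integral_congr_ae (u.grad_conj.mono fun x hx => ?_)
  simp only [hx, conjVec, Complex.mul_conj, Complex.normSq_eq_norm_sq]
  change _ = (‖u.grad x‖ : ℂ) ^ 2
  rw [← Complex.ofReal_pow, EuclideanSpace.norm_sq_eq]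
  push_cast
  rfl

lemma unperturbedL_coercive (a : ℝ) (u : H1 U) :
    min 1 a * ‖u‖ ^ 2 ≤ (unperturbedL a U u u.conj).re := by
  rw [unperturbedL_apply, unperturbedForm_conj, Complex.ofReal_re, H1.norm_sq]
  have h1 := mul_le_mul_of_nonneg_right (min_le_left 1 a) (sq_nonneg ‖u.1.snd‖)
  have h2 := mul_le_mul_of_nonneg_right (min_le_right 1 a) (sq_nonneg ‖u.1.fst‖)
  linarith

/-- The a priori estimate that later converts bounds by ‖u‖ into bounds by ‖Au‖. -/
lemma unperturbedL_lower_bound (a : ℝ) (u : H1 U) :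
    min 1 a * ‖u‖ ≤ ‖unperturbedL a U u‖ :=
   mul_norm_le_norm_of_apply _ u.norm_conj.le
    ((unperturbedL_coercive a u).trans (Complex.re_le_norm _))

end Forms

/-! ### Partial derivatives and products with smooth functions. -/

section PartialDeriv

lemma partialDeriv_mul {m φ : Plane → ℝ} (hm : ContDiff ℝ ∞ m) (hφ : ContDiff ℝ ∞ φ) (i : Fin 2)
    (x : Plane) : partialDeriv i (fun y => m y * φ y) x =
      m x * partialDeriv i φ x + partialDeriv i m x * φ x := by
  have h1 := (hm.differentiable (by simp)).differentiableAt (x := x)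
  have h2 := (hφ.differentiable (by simp)).differentiableAt (x := x)
  unfold partialDeriv
  rw [fderiv_fun_mul h1 h2]
  simp [mul_comm]

lemma contDiff_comp_coord {c : ℝ → ℝ} (hc : ContDiff ℝ ∞ c) (i : Fin 2) :
    ContDiff ℝ ∞ (fun x : Plane => c (x i)) := by fun_prop

lemma partialDeriv_comp_coord {c : ℝ → ℝ} (hc : ContDiff ℝ ∞ c) (i j : Fin 2) (x : Plane) :
    partialDeriv i (fun y : Plane => c (y j)) x = if i = j then deriv c (x j) else 0 := by
  have h1 := (hc.differentiable (by simp)).differentiableAt (x := x j)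
  have h2 : HasFDerivAt (fun y : Plane => y j) (EuclideanSpace.proj (𝕜 := ℝ) j) x :=
    (EuclideanSpace.proj (𝕜 := ℝ) j).hasFDerivAt
  have h3 := (h1.hasDerivAt.comp_hasFDerivAt x h2).fderiv
  unfold partialDeriv
  erw [h3]
  by_cases hij : i = j
  · subst hij; simp
  · simp [hij, Ne.symm hij]

lemma contDiff_deriv {c : ℝ → ℝ} (hc : ContDiff ℝ ∞ c) : ContDiff ℝ ∞ (deriv c) :=
  (contDiff_infty_iff_deriv.1 hc).2

/-- The product of a function with a weak gradient and a smooth function. -/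
lemma IsWeakGradient.smooth_mul {U : Set Plane} {f : Plane → ℂ}
    {g : Plane → EuclideanSpace ℂ (Fin 2)} (h : IsWeakGradient U f g)
    (hf : MemLp f 2 (volume.restrict U)) (hg : MemLp g 2 (volume.restrict U))
    {m : Plane → ℝ} (hm : ContDiff ℝ ∞ m) :
    IsWeakGradient U (fun x => (m x : ℂ) * f x)
      (fun x => WithLp.toLp 2 fun i => (m x : ℂ) * g x i + (partialDeriv i m x : ℂ) * f x) := by
  intro φ hφ hc hs i
  -- The product rule is moved onto the test side: mφ is again a test function, with ∂(mφ) = m∂φ +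
  -- (∂m)φ.
  have hmφ : ContDiff ℝ ∞ (fun x => m x * φ x) := hm.mul hφ
  have hmc : HasCompactSupport (fun x => m x * φ x) := hc.mul_left
  have key := h _ hmφ hmc ((tsupport_mul_subset_right).trans hs) i
  have i1 : Integrable (fun x => (partialDeriv i (fun y => m y * φ y) x : ℂ) * f x)
      (volume.restrict U) := (partialDeriv_memLp hmφ hmc U i).integrable_mul hf
  have hd : Continuous (fun x => partialDeriv i m x) :=
    (hm.continuous_fderiv (by simp)).clm_apply continuous_const
  have hdφ : MemLp (fun x => ((partialDeriv i m x * φ x : ℝ) : ℂ)) 2 (volume.restrict U) :=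
    (((hd.mul hφ.continuous).memLp_of_hasCompactSupport (μ := volume.restrict U)
      hc.mul_left).ofReal)
  have i2 : Integrable (fun x => ((partialDeriv i m x * φ x : ℝ) : ℂ) * f x)
      (volume.restrict U) := hdφ.integrable_mul hf
  have i3 : Integrable (fun x => ((m x * φ x : ℝ) : ℂ) * g x i) (volume.restrict U) :=
    (testFunction_memLp hmφ hmc U).integrable_mul (coord_memLp hg i)
  have e1 : ∫ x in U, (partialDeriv i φ x : ℂ) * ((m x : ℂ) * f x) =
      ∫ x in U, ((partialDeriv i (fun y => m y * φ y) x : ℂ) * f x -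
        ((partialDeriv i m x * φ x : ℝ) : ℂ) * f x) := by
    congr 1 with x
    rw [partialDeriv_mul hm hφ]
    push_cast
    ring
  have e2 : ∫ x in U, (φ x : ℂ) * ((m x : ℂ) * g x i + (partialDeriv i m x : ℂ) * f x) =
      ∫ x in U, (((m x * φ x : ℝ) : ℂ) * g x i +
        ((partialDeriv i m x * φ x : ℝ) : ℂ) * f x) := by
    congr 1 with x
    push_cast
    ring
  change _ = -∫ x in U, (φ x : ℂ) * ((m x : ℂ) * g x i + (partialDeriv i m x : ℂ) * f x)
  rw [e1, e2, integral_sub i1 i2, integral_add i3 i2, key]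
  ring

lemma memLp_bdd_mul {U : Set Plane} {f : Plane → ℂ} (hf : MemLp f 2 (volume.restrict U))
    {m : Plane → ℝ} (hm : Continuous m) {K : ℝ} (hK : ∀ᵐ x ∂(volume.restrict U), |m x| ≤ K) :
    MemLp (fun x => (m x : ℂ) * f x) 2 (volume.restrict U) := by
  refine MemLp.of_le_mul hf
    ((Complex.continuous_ofReal.comp hm).aestronglyMeasurable.mul hf.1) (c := K) ?_
  filter_upwards [hK] with x hx
  rw [norm_mul, Complex.norm_real]
  exact mul_le_mul_of_nonneg_right hx (norm_nonneg _)

end PartialDeriv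

/-! ### Change of variables under (x₁, x₂ c(x₁)). -/

section Stretch

/-- The map `(x₁, x₂) ↦ (x₁, x₂ c(x₁))`. -/
def stretch (c : ℝ → ℝ) (x : Plane) : Plane := !₂[x 0, x 1 * c (x 0)]

/-- The derivative of `stretch c`. -/
def stretchDeriv (c : ℝ → ℝ) (x : Plane) : Plane →L[ℝ] Plane :=
  LinearMap.toContinuousLinearMap
    { toFun := fun v => !₂[v 0, c (x 0) * v 1 + x 1 * deriv c (x 0) * v 0]
      map_add' := fun v w => by ext i; fin_cases i <;> simp; ring
      map_smul' := fun r v => by ext i; fin_cases i <;> simp; ring }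

lemma stretchDeriv_apply (c : ℝ → ℝ) (x v : Plane) :
    stretchDeriv c x v = !₂[v 0, c (x 0) * v 1 + x 1 * deriv c (x 0) * v 0] := rfl

lemma det_stretchDeriv (c : ℝ → ℝ) (x : Plane) : (stretchDeriv c x).det = c (x 0) := by
  rw [ContinuousLinearMap.det, ← LinearMap.det_toMatrix (EuclideanSpace.basisFun (Fin 2) ℝ).toBasis,
    Matrix.det_fin_two]
  simp [LinearMap.toMatrix_apply, stretchDeriv_apply]

variable {c : ℝ → ℝ}

lemma hasFDerivAt_stretch (hc : ContDiff ℝ ∞ c) (x : Plane) :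
    HasFDerivAt (stretch c) (stretchDeriv c x) x := by
  have hp : ∀ j : Fin 2, HasFDerivAt (fun y : Plane => y j) (EuclideanSpace.proj (𝕜 := ℝ) j) x :=
    fun j => (EuclideanSpace.proj (𝕜 := ℝ) j).hasFDerivAt
  have h1 := ((hc.differentiable (by simp)).differentiableAt (x := x 0)).hasDerivAt
  have h2 := h1.comp_hasFDerivAt x (hp 0)
  rw [← hasFDerivWithinAt_univ, hasFDerivWithinAt_euclidean]
  intro i
  rw [hasFDerivWithinAt_univ]
  fin_cases i
  · refine (hp 0).congr_fderiv ?_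
    ext v
    simp [stretchDeriv_apply]
  · refine ((hp 1).mul h2).congr_fderiv ?_
    ext v
    simp [stretchDeriv_apply]
    ring

lemma contDiff_stretch (hc : ContDiff ℝ ∞ c) : ContDiff ℝ ∞ (stretch c) := by
  rw [contDiff_euclidean]
  intro i
  fin_cases i
  · change ContDiff ℝ ∞ fun x : Plane => x 0
    fun_prop
  · change ContDiff ℝ ∞ fun x : Plane => x 1 * c (x 0)
    fun_prop

/-- `stretch c` as a homeomorphism of the plane. -/
def stretchHomeomorph (hc : ContDiff ℝ ∞ c) (hpos : ∀ t, 0 < c t) : Plane ≃ₜ Plane where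
  toFun := stretch c
  invFun := stretch fun t => (c t)⁻¹
  left_inv x := by
    ext i
    fin_cases i
    · rfl
    · simp [stretch, (hpos (x 0)).ne']
  right_inv x := by
    ext i
    fin_cases i
    · rfl
    · simp [stretch, (hpos (x 0)).ne']
  continuous_toFun := (contDiff_stretch hc).continuous
  continuous_invFun := (contDiff_stretch (hc.inv fun t => (hpos t).ne')).continuous

lemma stretch_injective (hc : ContDiff ℝ ∞ c) (hpos : ∀ t, 0 < c t) :
    Function.Injective (stretch c) := (stretchHomeomorph hc hpos).injective

lemma invFunOn_stretch (hc : ContDiff ℝ ∞ c) (hpos : ∀ t, 0 < c t) {U : Set Plane} {x : Plane}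
    (hx : x ∈ U) : Function.invFunOn (stretch c) U (stretch c x) = x :=
  (stretch_injective hc hpos).injOn.leftInvOn_invFunOn hx

lemma absJacobian_stretch (hc : ContDiff ℝ ∞ c) (hpos : ∀ t, 0 < c t) (x : Plane) :
    absJacobian (stretch c) x = c (x 0) := by
  rw [absJacobian, (hasFDerivAt_stretch hc x).fderiv, det_stretchDeriv, abs_of_pos (hpos _)]

lemma partialDeriv_comp_stretch (hc : ContDiff ℝ ∞ c) {φ : Plane → ℝ} (hφ : ContDiff ℝ ∞ φ)
    (i : Fin 2) (x : Plane) : partialDeriv i (φ ∘ stretch c) x =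
      fderiv ℝ φ (stretch c x) (stretchDeriv c x (EuclideanSpace.single i 1)) := by
  have h1 := ((hφ.differentiable (by simp)).differentiableAt (x := stretch c x)).hasFDerivAt
  rw [partialDeriv, (h1.comp x (hasFDerivAt_stretch hc x)).fderiv]
  rfl

lemma partialDeriv_zero_comp_stretch (hc : ContDiff ℝ ∞ c) {φ : Plane → ℝ}
    (hφ : ContDiff ℝ ∞ φ) (x : Plane) : partialDeriv 0 (φ ∘ stretch c) x =
      partialDeriv 0 φ (stretch c x) + x 1 * deriv c (x 0) * partialDeriv 1 φ (stretch c x) := by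
  have : stretchDeriv c x (EuclideanSpace.single 0 1) = EuclideanSpace.single 0 1 +
      (x 1 * deriv c (x 0)) • EuclideanSpace.single 1 1 := by
    ext i; fin_cases i <;> simp [stretchDeriv_apply]
  rw [partialDeriv_comp_stretch hc hφ, this, map_add, map_smul]
  rfl

lemma partialDeriv_one_comp_stretch (hc : ContDiff ℝ ∞ c) {φ : Plane → ℝ}
    (hφ : ContDiff ℝ ∞ φ) (x : Plane) : partialDeriv 1 (φ ∘ stretch c) x =
      c (x 0) * partialDeriv 1 φ (stretch c x) := by
  have : stretchDeriv c x (EuclideanSpace.single 1 1) =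
      c (x 0) • EuclideanSpace.single 1 1 := by
    ext i; fin_cases i <;> simp [stretchDeriv_apply]
  rw [partialDeriv_comp_stretch hc hφ, this, map_smul]
  rfl

variable {U : Set Plane}

lemma integral_image_stretch (hc : ContDiff ℝ ∞ c) (hpos : ∀ t, 0 < c t) (hU : IsOpen U)
    (F : Plane → ℂ) :
    ∫ y in stretch c '' U, F y = ∫ x in U, (c (x 0) : ℂ) * F (stretch c x) := by
  rw [integral_image_eq_integral_abs_det_fderiv_smul volume hU.measurableSet
    (fun x _ => (hasFDerivAt_stretch hc x).hasFDerivWithinAt) (stretch_injective hc hpos).injOn]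
  simp only [det_stretchDeriv, abs_of_pos (hpos _), Complex.real_smul]

/-- The gradient of `f ∘ (stretch c)⁻¹`, pulled back by `stretch c`, in terms of the gradient `g`
of `f`. -/
def stretchGrad (c : ℝ → ℝ) (g : Plane → EuclideanSpace ℂ (Fin 2)) (x : Plane) :
    EuclideanSpace ℂ (Fin 2) :=
  !₂[g x 0 - (x 1 * deriv c (x 0) * (c (x 0))⁻¹ : ℝ) * g x 1, ((c (x 0))⁻¹ : ℝ) * g x 1]

lemma stretchGrad_zero (c : ℝ → ℝ) (g : Plane → EuclideanSpace ℂ (Fin 2)) (x : Plane) :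
    stretchGrad c g x 0 =
      g x 0 - (x 1 * deriv c (x 0) * (c (x 0))⁻¹ : ℝ) * g x 1 := rfl

lemma stretchGrad_one (c : ℝ → ℝ) (g : Plane → EuclideanSpace ℂ (Fin 2)) (x : Plane) :
    stretchGrad c g x 1 = ((c (x 0))⁻¹ : ℝ) * g x 1 := rfl

/-- The chain rule is proved by duality: integrals over the image are pulled back, and the weak
gradient of f is tested against multiples of φ ∘ `stretch c`. No approximation of f by smooth
functions is involved. -/
lemma IsWeakGradient.pushForward_stretch (hc : ContDiff ℝ ∞ c) (hpos : ∀ t, 0 < c t)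
    (hU : IsOpen U) {f : Plane → ℂ} {g : Plane → EuclideanSpace ℂ (Fin 2)}
    (hf : MemLp f 2 (volume.restrict U)) (hg : MemLp g 2 (volume.restrict U))
    (h : IsWeakGradient U f g) :
    IsWeakGradient (stretch c '' U) (pushForward (stretch c) U f)
      (fun y => stretchGrad c g (Function.invFunOn (stretch c) U y)) := by
  intro φ hφ hφc hs i
  rw [integral_image_stretch hc hpos hU, integral_image_stretch hc hpos hU]
  have hΦ : ContDiff ℝ ∞ (φ ∘ stretch c) := hφ.comp (contDiff_stretch hc)
  have hΦc : HasCompactSupport (φ ∘ stretch c) :=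
    hφc.comp_homeomorph (stretchHomeomorph hc hpos)
  have hΦs : tsupport (φ ∘ stretch c) ⊆ U := by
    have h1 : tsupport (φ ∘ stretch c) = stretch c ⁻¹' tsupport φ :=
      tsupport_comp_eq_preimage φ (stretchHomeomorph hc hpos)
    rw [h1, ← preimage_image_eq U (stretch_injective hc hpos)]
    exact preimage_mono hs
  have e1 : ∀ i, ∫ x in U, (c (x 0) : ℂ) * ((partialDeriv i φ (stretch c x) : ℂ) *
      pushForward (stretch c) U f (stretch c x)) =
      ∫ x in U, ((c (x 0) * partialDeriv i φ (stretch c x) : ℝ) : ℂ) * f x := fun i =>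
    setIntegral_congr_fun hU.measurableSet fun x hx => by
      simp only [pushForward, invFunOn_stretch hc hpos hx]
      push_cast
      ring
  have e2 : ∀ i, ∫ x in U, (c (x 0) : ℂ) * ((φ (stretch c x) : ℂ) *
      stretchGrad c g (Function.invFunOn (stretch c) U (stretch c x)) i) =
      ∫ x in U, ((c (x 0) * φ (stretch c x) : ℝ) : ℂ) * stretchGrad c g x i := fun i =>
    setIntegral_congr_fun hU.measurableSet fun x hx => by
      simp only [invFunOn_stretch hc hpos hx]
      push_cast
      ring
  rw [e1, e2]
  have hc0 : ∀ x : Plane, (c (x 0) : ℂ) ≠ 0 := fun x => by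
    exact_mod_cast (hpos (x 0)).ne'
  fin_cases i
  · have hm0 : ContDiff ℝ ∞ (fun x : Plane => c (x 0)) := contDiff_comp_coord hc 0
    have hx1 : ContDiff ℝ ∞ (fun x : Plane => x 1) := contDiff_comp_coord contDiff_id 1
    have hd0 : ContDiff ℝ ∞ (fun x : Plane => deriv c (x 0)) :=
      contDiff_comp_coord (contDiff_deriv hc) 0
    have hm1 : ContDiff ℝ ∞ (fun x : Plane => x 1 * deriv c (x 0)) := hx1.mul hd0
    have hψ0 := hm0.mul hΦ
    have hψ1 := hm1.mul hΦ
    have hψ0c : HasCompactSupport (fun x => c (x 0) * (φ ∘ stretch c) x) := hΦc.mul_left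
    have hψ1c : HasCompactSupport (fun x => x 1 * deriv c (x 0) * (φ ∘ stretch c) x) :=
      hΦc.mul_left
    have k0 := h _ hψ0 hψ0c (tsupport_mul_subset_right.trans hΦs) 0
    have k1 := h _ hψ1 hψ1c (tsupport_mul_subset_right.trans hΦs) 1
    have i1 : Integrable _ (volume.restrict U) :=
      (partialDeriv_memLp hψ0 hψ0c U 0).integrable_mul hf
    have i2 : Integrable _ (volume.restrict U) :=
      (partialDeriv_memLp hψ1 hψ1c U 1).integrable_mul hf
    have i3 : Integrable _ (volume.restrict U) :=
      (testFunction_memLp hψ0 hψ0c U).integrable_mul (coord_memLp hg 0)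
    have i4 : Integrable _ (volume.restrict U) :=
      (testFunction_memLp hψ1 hψ1c U).integrable_mul (coord_memLp hg 1)
    -- With Φ = φ ∘ `stretch c` this is c(∂₁φ ∘ h) = ∂₁(cΦ) - ∂₂(x₂c'Φ): the terms c'Φ cancel, as do
    -- the terms with ∂₂φ. A divergence form is what allows weak derivatives of f to be used.
    have hd : ∀ x : Plane, c (x 0) * partialDeriv 0 φ (stretch c x) =
        partialDeriv 0 (fun x => c (x 0) * (φ ∘ stretch c) x) x -
        partialDeriv 1 (fun x => x 1 * deriv c (x 0) * (φ ∘ stretch c) x) x := by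
      intro x
      have p1 : partialDeriv 1 (fun x : Plane => x 1 * deriv c (x 0)) x = deriv c (x 0) := by
        have q1 := partialDeriv_comp_coord contDiff_id 1 1 x
        have q2 := partialDeriv_comp_coord (contDiff_deriv hc) 1 0 x
        simp only [id] at q1
        rw [partialDeriv_mul hx1 hd0, q1, q2]
        simp [deriv_id]
      rw [partialDeriv_mul hm0 hΦ, partialDeriv_mul hm1 hΦ, p1,
        partialDeriv_comp_coord hc, partialDeriv_zero_comp_stretch hc hφ,
        partialDeriv_one_comp_stretch hc hφ]
      simp only [if_true]
      ring
    have f1 : ∫ x in U, ((c (x 0) * partialDeriv 0 φ (stretch c x) : ℝ) : ℂ) * f x =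
        ∫ x in U, ((partialDeriv 0 (fun x => c (x 0) * (φ ∘ stretch c) x) x : ℂ) * f x -
        (partialDeriv 1 (fun x => x 1 * deriv c (x 0) * (φ ∘ stretch c) x) x : ℂ) * f x) := by
      congr 1 with x
      rw [hd]
      push_cast
      ring
    have f2 : ∫ x in U, ((c (x 0) * φ (stretch c x) : ℝ) : ℂ) * stretchGrad c g x 0 =
        ∫ x in U, (((c (x 0) * (φ ∘ stretch c) x : ℝ) : ℂ) * g x 0 -
        ((x 1 * deriv c (x 0) * (φ ∘ stretch c) x : ℝ) : ℂ) * g x 1) := by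
      congr 1 with x
      have := hc0 x
      rw [stretchGrad_zero, Function.comp_apply]
      push_cast
      field_simp
    have f3 := integral_sub i1 i2
    have f4 := integral_sub i3 i4
    simp only [Fin.zero_eta]
    rw [f1, f2]
    refine f3.trans ?_
    rw [show (∫ x in U, (((c (x 0) * (φ ∘ stretch c) x : ℝ) : ℂ) * g x 0 -
        ((x 1 * deriv c (x 0) * (φ ∘ stretch c) x : ℝ) : ℂ) * g x 1)) = _ from f4]
    erw [k0, k1]
    simp only [Pi.mul_apply]
    ring
  -- In the vertical direction the Jacobian c is absorbed at once, since c(∂₂φ ∘ h) = ∂₂Φ.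
  · have k := h _ hΦ hΦc hΦs 1
    simp only [Fin.mk_one]
    have f1 : ∫ x in U, ((c (x 0) * φ (stretch c x) : ℝ) : ℂ) * stretchGrad c g x 1 =
        ∫ x in U, ((φ ∘ stretch c) x : ℂ) * g x 1 := by
      congr 1 with x
      have := hc0 x
      rw [stretchGrad_one, Function.comp_apply]
      push_cast
      field_simp
    rw [f1, ← k]
    simp only [partialDeriv_one_comp_stretch hc hφ]

lemma map_stretch_withDensity (hc : ContDiff ℝ ∞ c) (hpos : ∀ t, 0 < c t) (hU : IsOpen U) :
    Measure.map (stretch c) ((volume.restrict U).withDensity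
      fun x => ENNReal.ofReal (c (x 0))) = volume.restrict (stretch c '' U) := by
  rw [← map_withDensity_abs_det_fderiv_eq_addHaar volume hU.measurableSet.nullMeasurableSet
    (fun x _ => (hasFDerivAt_stretch hc x).hasFDerivWithinAt) (stretch_injective hc hpos).injOn]
  simp only [det_stretchDeriv, abs_of_pos (hpos _)]

/-- The measure on the image is the push-forward of c dx, which is dominated by K dx. -/
lemma memLp_comp_invFunOn_stretch {E : Type*} [NormedAddCommGroup E] (hc : ContDiff ℝ ∞ c)
    (hpos : ∀ t, 0 < c t) {K : ℝ} (hK : ∀ t, c t ≤ K) (hU : IsOpen U) {F : Plane → E}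
    (hF : MemLp F 2 (volume.restrict U)) :
    MemLp (fun y => F (Function.invFunOn (stretch c) U y)) 2
      (volume.restrict (stretch c '' U)) := by
  rw [← map_stretch_withDensity hc hpos hU,
    (stretchHomeomorph hc hpos).measurableEmbedding.memLp_map_measure_iff (f := stretch c)]
  have h1 : MemLp ((fun y => F (Function.invFunOn (stretch c) U y)) ∘ stretch c) 2
      (volume.restrict U) := by
    refine hF.ae_eq ?_
    filter_upwards [ae_restrict_mem hU.measurableSet] with x hx
    simp only [Function.comp_apply, invFunOn_stretch hc hpos hx]
  refine h1.of_measure_le_smul (c := ENNReal.ofReal K) ENNReal.ofReal_ne_top ?_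
  rw [← withDensity_const]
  exact withDensity_mono (Eventually.of_forall fun x => ENNReal.ofReal_le_ofReal (hK _))

/-- The density c is positive everywhere, so null sets of the image pull back to null sets. -/
lemma ae_comp_stretch (hc : ContDiff ℝ ∞ c) (hpos : ∀ t, 0 < c t) (hU : IsOpen U)
    {P : Plane → Prop} (hP : ∀ᵐ y ∂(volume.restrict (stretch c '' U)), P y) :
    ∀ᵐ x ∂(volume.restrict U), P (stretch c x) := by
  rw [← map_stretch_withDensity hc hpos hU,
    (stretchHomeomorph hc hpos).measurableEmbedding.ae_map_iff (f := stretch c),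
    ae_withDensity_iff (by
      have := hc.continuous
      fun_prop)] at hP
  filter_upwards [hP] with x hx
  exact hx (ENNReal.ofReal_pos.2 (hpos _)).ne'

lemma stretchGrad_memLp (hc : ContDiff ℝ ∞ c) (hpos : ∀ t, 0 < c t) {δ K : ℝ} (hδ : 0 < δ)
    (hδc : ∀ t, δ ≤ c t) (hK : ∀ t, |deriv c t| ≤ K) (hU : IsOpen U)
    (hU1 : ∀ x ∈ U, |x 1| ≤ 1)
    {g : Plane → EuclideanSpace ℂ (Fin 2)} (hg : MemLp g 2 (volume.restrict U)) :
    MemLp (stretchGrad c g) 2 (volume.restrict U) := by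
  have hcc := hc.continuous
  have hci : Continuous fun x : Plane => (c (x 0))⁻¹ :=
    Continuous.inv₀ (by fun_prop) fun x => (hpos (x 0)).ne'
  have hcd := (contDiff_deriv hc).continuous
  have hinv : ∀ t, |(c t)⁻¹| ≤ δ⁻¹ := fun t => by
    rw [abs_of_pos (inv_pos.2 (hpos t))]
    exact inv_anti₀ hδ (hδc t)
  have b1 : MemLp (fun x : Plane => (((c (x 0))⁻¹ : ℝ) : ℂ) * g x 1) 2 (volume.restrict U) :=
    memLp_bdd_mul (coord_memLp hg 1) hci (K := δ⁻¹)
      (Eventually.of_forall fun x => hinv _)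
  have b0 : MemLp (fun x : Plane => ((x 1 * deriv c (x 0) * (c (x 0))⁻¹ : ℝ) : ℂ) * g x 1) 2
      (volume.restrict U) := by
    refine memLp_bdd_mul (coord_memLp hg 1) (.mul (by fun_prop) hci) (K := 1 * K * δ⁻¹) ?_
    filter_upwards [ae_restrict_mem hU.measurableSet] with x hx
    rw [abs_mul, abs_mul]
    exact mul_le_mul (mul_le_mul (hU1 x hx) (hK _) (abs_nonneg _) zero_le_one) (hinv _)
      (abs_nonneg _) (by
        have := (abs_nonneg _).trans (hK 0)
        positivity)
  refine MemLp.of_eval_piLp fun i => ?_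
  fin_cases i
  · exact (coord_memLp hg 0).sub b0
  · exact b1

/-- `weakGradient` is defined by a choice; uniqueness identifies it almost everywhere with the
explicit formula, and this is then transported back to U. The bound on x₂ keeps x₂c'/c bounded. -/
lemma memH1_pushForward_stretch (hc : ContDiff ℝ ∞ c) {δ K K' : ℝ} (hδ : 0 < δ)
    (hδc : ∀ t, δ ≤ c t) (hK : ∀ t, |deriv c t| ≤ K) (hK' : ∀ t, c t ≤ K') (hU : IsOpen U)
    (hU1 : ∀ x ∈ U, |x 1| ≤ 1) {f : Plane → ℂ} {g : Plane → EuclideanSpace ℂ (Fin 2)}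
    (hf : MemLp f 2 (volume.restrict U)) (hg : MemLp g 2 (volume.restrict U))
    (h : IsWeakGradient U f g) :
    MemH1 (stretch c '' U) (pushForward (stretch c) U f) ∧
      pulledBackGradient (stretch c) U f =ᵐ[volume.restrict U] stretchGrad c g := by
  have hpos : ∀ t, 0 < c t := fun t => hδ.trans_le (hδc t)
  have m1 : MemLp (pushForward (stretch c) U f) 2 (volume.restrict (stretch c '' U)) :=
    memLp_comp_invFunOn_stretch hc hpos hK' hU hf
  have m2 := memLp_comp_invFunOn_stretch hc hpos hK' hU
    (stretchGrad_memLp hc hpos hδ hδc hK hU hU1 hg)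
  have hw := h.pushForward_stretch hc hpos hU hf hg
  have hO : IsOpen (stretch c '' U) := (stretchHomeomorph hc hpos).isOpenMap _ hU
  refine ⟨memH1_of_isWeakGradient m1 m2 hw, ?_⟩
  filter_upwards [ae_comp_stretch hc hpos hU (weakGradient_ae_eq hO m1 m2 hw),
    ae_restrict_mem hU.measurableSet] with x hx hxU
  rw [pulledBackGradient, hx, invFunOn_stretch hc hpos hxU]

end Stretch

/-! ### The pulled back form as a small perturbation. -/

section Perturbation

variable {c : ℝ → ℝ} {U : Set Plane}

/-- The gradient of `f / c(x₁)` when `g` is the gradient of `f`. -/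
def divGrad (c : ℝ → ℝ) (f : Plane → ℂ) (g : Plane → EuclideanSpace ℂ (Fin 2)) (x : Plane) :
    EuclideanSpace ℂ (Fin 2) :=
  !₂[((c (x 0))⁻¹ : ℝ) * g x 0 - (deriv c (x 0) * (c (x 0))⁻¹ * (c (x 0))⁻¹ : ℝ) * f x,
    ((c (x 0))⁻¹ : ℝ) * g x 1]

lemma divGrad_zero (c : ℝ → ℝ) (f : Plane → ℂ) (g : Plane → EuclideanSpace ℂ (Fin 2))
    (x : Plane) : divGrad c f g x 0 = ((c (x 0))⁻¹ : ℝ) * g x 0 -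
      (deriv c (x 0) * (c (x 0))⁻¹ * (c (x 0))⁻¹ : ℝ) * f x := rfl

lemma divGrad_one (c : ℝ → ℝ) (f : Plane → ℂ) (g : Plane → EuclideanSpace ℂ (Fin 2))
    (x : Plane) : divGrad c f g x 1 = ((c (x 0))⁻¹ : ℝ) * g x 1 := rfl

lemma divJacobian_stretch (hc : ContDiff ℝ ∞ c) (hpos : ∀ t, 0 < c t) (f : Plane → ℂ) :
    divJacobian (stretch c) f = fun x => (((c (x 0))⁻¹ : ℝ) : ℂ) * f x := by
  ext x
  rw [divJacobian, absJacobian_stretch hc hpos, div_eq_inv_mul, Complex.ofReal_inv]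

lemma IsWeakGradient.divJacobian_stretch (hc : ContDiff ℝ ∞ c) (hpos : ∀ t, 0 < c t)
    {f : Plane → ℂ} {g : Plane → EuclideanSpace ℂ (Fin 2)} (h : IsWeakGradient U f g)
    (hf : MemLp f 2 (volume.restrict U)) (hg : MemLp g 2 (volume.restrict U)) :
    IsWeakGradient U (divJacobian (stretch c) f) (divGrad c f g) := by
  have hci : ContDiff ℝ ∞ fun t => (c t)⁻¹ := hc.inv fun t => (hpos t).ne'
  have hd : ∀ t, deriv (fun t => (c t)⁻¹) t = -(deriv c t * (c t)⁻¹ * (c t)⁻¹) := fun t => by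
    have h1 := ((hc.differentiable (by simp)).differentiableAt (x := t)).hasDerivAt
    rw [(h1.fun_inv (hpos t).ne').deriv]
    have := (hpos t).ne'
    field_simp
  have key := h.smooth_mul hf hg (contDiff_comp_coord hci 0)
  rw [_root_.divJacobian_stretch hc hpos]
  convert! key using 2 with x
  ext i
  fin_cases i
  · simp only [Fin.zero_eta, divGrad_zero, partialDeriv_comp_coord hci, hd, if_true]
    push_cast
    ring
  · simp only [Fin.mk_one, divGrad_one, partialDeriv_comp_coord hci]
    simp

lemma divGrad_memLp (hc : ContDiff ℝ ∞ c) {δ K : ℝ} (hδ : 0 < δ)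
    (hδc : ∀ t, δ ≤ c t) (hK : ∀ t, |deriv c t| ≤ K)
    {f : Plane → ℂ} {g : Plane → EuclideanSpace ℂ (Fin 2)}
    (hf : MemLp f 2 (volume.restrict U)) (hg : MemLp g 2 (volume.restrict U)) :
    MemLp (divGrad c f g) 2 (volume.restrict U) := by
  have hpos : ∀ t, 0 < c t := fun t => hδ.trans_le (hδc t)
  have hcc := hc.continuous
  have hci : Continuous fun x : Plane => (c (x 0))⁻¹ :=
    Continuous.inv₀ (by fun_prop) fun x => (hpos (x 0)).ne'
  have hcd := (contDiff_deriv hc).continuous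
  have hinv : ∀ t, |(c t)⁻¹| ≤ δ⁻¹ := fun t => by
    rw [abs_of_pos (inv_pos.2 (hpos t))]
    exact inv_anti₀ hδ (hδc t)
  have b : ∀ i, MemLp (fun x : Plane => (((c (x 0))⁻¹ : ℝ) : ℂ) * g x i) 2 (volume.restrict U) :=
    fun i => memLp_bdd_mul (coord_memLp hg i) hci (K := δ⁻¹)
      (Eventually.of_forall fun x => hinv _)
  have b0 : MemLp (fun x : Plane =>
      ((deriv c (x 0) * (c (x 0))⁻¹ * (c (x 0))⁻¹ : ℝ) : ℂ) * f x) 2 (volume.restrict U) := by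
    refine memLp_bdd_mul hf (.mul (.mul (by fun_prop) hci) hci) (K := K * δ⁻¹ * δ⁻¹)
      (Eventually.of_forall fun x => ?_)
    have hK0 := (abs_nonneg _).trans (hK 0)
    rw [abs_mul, abs_mul]
    exact mul_le_mul (mul_le_mul (hK _) (hinv _) (abs_nonneg _) hK0) (hinv _)
      (abs_nonneg _) (by positivity)
  refine MemLp.of_eval_piLp fun i => ?_
  fin_cases i
  · exact (b 0).sub b0
  · exact b 1

lemma divJacobian_stretch_memLp (hc : ContDiff ℝ ∞ c) {δ : ℝ} (hδ : 0 < δ)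
    (hδc : ∀ t, δ ≤ c t) {f : Plane → ℂ} (hf : MemLp f 2 (volume.restrict U)) :
    MemLp (divJacobian (stretch c) f) 2 (volume.restrict U) := by
  have hpos : ∀ t, 0 < c t := fun t => hδ.trans_le (hδc t)
  have hcc := hc.continuous
  rw [divJacobian_stretch hc hpos]
  refine memLp_bdd_mul hf (Continuous.inv₀ (by fun_prop) fun x => (hpos (x 0)).ne') (K := δ⁻¹)
    (Eventually.of_forall fun x => ?_)
  rw [abs_of_pos (inv_pos.2 (hpos _))]
  exact inv_anti₀ hδ (hδc _)

lemma pulledBackFormWellDefined_stretch (hc : ContDiff ℝ ∞ c) {δ K K' : ℝ} (hδ : 0 < δ)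
    (hδc : ∀ t, δ ≤ c t) (hK : ∀ t, |deriv c t| ≤ K) (hK' : ∀ t, c t ≤ K') (hU : IsOpen U)
    (hU1 : ∀ x ∈ U, |x 1| ≤ 1) : PulledBackFormWellDefined (stretch c) U := fun u =>
  have hpos : ∀ t, 0 < c t := fun t => hδ.trans_le (hδc t)
  ⟨(memH1_pushForward_stretch hc hδ hδc hK hK' hU hU1 u.val_memLp u.grad_memLp
    u.isWeakGradient).1,
  (memH1_pushForward_stretch hc hδ hδc hK hK' hU hU1
    (divJacobian_stretch_memLp hc hδ hδc u.val_memLp)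
    (divGrad_memLp hc hδ hδc hK u.val_memLp u.grad_memLp)
    (u.isWeakGradient.divJacobian_stretch hc hpos u.val_memLp u.grad_memLp)).1⟩

lemma ae_norm_ofReal_le (hU : IsOpen U) {m : Plane → ℝ} {K : ℝ} (hK : ∀ x ∈ U, |m x| ≤ K) :
    ∀ᵐ x ∂(volume.restrict U), ‖(m x : ℂ)‖ ≤ K := by
  filter_upwards [ae_restrict_mem hU.measurableSet] with x hx
  rw [Complex.norm_real]
  exact hK x hx

/-- The bounded form `∫ m (P u) (Q ψ)` on `H¹(U)`. -/
def weightedForm (hU : IsOpen U) {m : Plane → ℝ} (hm : Continuous m) {K : ℝ}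
    (hK0 : 0 ≤ K) (hK : ∀ x ∈ U, |m x| ≤ K) (P Q : H1 U →L[ℂ] Lp ℂ 2 (volume.restrict U)) :
    H1 U →L[ℂ] Hneg1 U :=
  (weightedPairing (Complex.continuous_ofReal.comp hm) hK0
    (ae_norm_ofReal_le hU hK)).bilinearComp P Q

section WeightedForm

variable (hU : IsOpen U) {m : Plane → ℝ} (hm : Continuous m) {K : ℝ}
    (hK0 : 0 ≤ K) (hK : ∀ x ∈ U, |m x| ≤ K) (P Q : H1 U →L[ℂ] Lp ℂ 2 (volume.restrict U))

lemma weightedForm_apply (u ψ : H1 U) :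
    weightedForm hU hm hK0 hK P Q u ψ = ∫ x in U, (m x : ℂ) * (P u x * Q ψ x) := rfl

lemma norm_weightedForm_le (hP : ∀ u, ‖P u‖ ≤ ‖u‖) (hQ : ∀ u, ‖Q u‖ ≤ ‖u‖) (u : H1 U) :
    ‖weightedForm hU hm hK0 hK P Q u‖ ≤ K * ‖u‖ := by
  refine ContinuousLinearMap.opNorm_le_bound _ (by positivity) fun ψ => ?_
  rw [weightedForm_apply, mul_assoc]
  exact (norm_integral_weighted_le hK0 (ae_norm_ofReal_le hU hK) _ _).trans
    (mul_le_mul_of_nonneg_left (mul_le_mul (hP u) (hQ ψ) (norm_nonneg _) (norm_nonneg _)) hK0)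

lemma weightedForm_apply_of_ae {u ψ : H1 U} {f g : Plane → ℂ} (hf : P u =ᵐ[volume.restrict U] f)
    (hg : Q ψ =ᵐ[volume.restrict U] g) :
    weightedForm hU hm hK0 hK P Q u ψ = ∫ x in U, (m x : ℂ) * (f x * g x) := by
  refine integral_congr_ae ?_
  filter_upwards [hf, hg] with x h1 h2
  rw [← h1, ← h2]
  rfl

end WeightedForm

lemma integral_add_six {μ : Measure Plane} {f₀ f₁ f₂ f₃ f₄ f₅ : Plane → ℂ}
    (h₀ : Integrable f₀ μ) (h₁ : Integrable f₁ μ) (h₂ : Integrable f₂ μ) (h₃ : Integrable f₃ μ)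
    (h₄ : Integrable f₄ μ) (h₅ : Integrable f₅ μ) :
    ∫ x, (f₀ x + (f₁ x + f₂ x + f₃ x + f₄ x + f₅ x)) ∂μ = ∫ x, f₀ x ∂μ +
      (∫ x, f₁ x ∂μ + ∫ x, f₂ x ∂μ + ∫ x, f₃ x ∂μ + ∫ x, f₄ x ∂μ + ∫ x, f₅ x ∂μ) := by
  have h12 := h₁.add h₂
  have h13 := h12.add h₃
  have h14 := h13.add h₄
  have h15 := h14.add h₅
  rw [← integral_add' h₁ h₂, ← integral_add' h12 h₃, ← integral_add' h13 h₄, ← integral_add' h14 h₅,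
    ← integral_add' h₀ h15]
  rfl

lemma norm_add_five_le {X : Type*} [SeminormedAddCommGroup X] {x₁ x₂ x₃ x₄ x₅ : X}
    {b₁ b₂ b₃ b₄ b₅ : ℝ} (h₁ : ‖x₁‖ ≤ b₁) (h₂ : ‖x₂‖ ≤ b₂) (h₃ : ‖x₃‖ ≤ b₃) (h₄ : ‖x₄‖ ≤ b₄)
    (h₅ : ‖x₅‖ ≤ b₅) : ‖x₁ + x₂ + x₃ + x₄ + x₅‖ ≤ b₁ + b₂ + b₃ + b₄ + b₅ :=
  norm_add_le_of_le (norm_add_le_of_le (norm_add_le_of_le (norm_add_le_of_le h₁ h₂) h₃) h₄) h₅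

/-- The logarithmic derivative of `c`, as a function of `x₁`. -/
def logSlope (c : ℝ → ℝ) (x : Plane) : ℝ := deriv c (x 0) * (c (x 0))⁻¹

/-- The slope of the pulled back vertical lines. -/
def shear (c : ℝ → ℝ) (x : Plane) : ℝ := x 1 * logSlope c x

/-- The coefficient of `∂₂u ∂₂ψ` in the perturbation. -/
def verticalDefect (c : ℝ → ℝ) (x : Plane) : ℝ := shear c x ^ 2 + ((c (x 0))⁻¹ ^ 2 - 1)

lemma continuous_logSlope (hc : ContDiff ℝ ∞ c) (hpos : ∀ t, 0 < c t) :
    Continuous (logSlope c) := by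
  have hcc := hc.continuous
  have hcd := (contDiff_deriv hc).continuous
  exact .mul (by fun_prop) (Continuous.inv₀ (by fun_prop) fun x => (hpos (x 0)).ne')

lemma continuous_shear (hc : ContDiff ℝ ∞ c) (hpos : ∀ t, 0 < c t) : Continuous (shear c) :=
  .mul (by fun_prop) (continuous_logSlope hc hpos)

lemma continuous_verticalDefect (hc : ContDiff ℝ ∞ c) (hpos : ∀ t, 0 < c t) :
    Continuous (verticalDefect c) := by
  have hcc := hc.continuous
  have h : Continuous fun x : Plane => (c (x 0))⁻¹ :=
    Continuous.inv₀ (by fun_prop) fun x => (hpos (x 0)).ne'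
  exact ((continuous_shear hc hpos).pow 2).add ((h.pow 2).sub continuous_const)

/-- As c ≥ 1/2, the inverse of c is at most 2. Quadratic terms are made linear by 2η · 2η ≤ 2η,
which uses η ≤ 1/2. -/
lemma coefficient_bounds {η : ℝ} (hη : η ≤ 1 / 2) (hc1 : ∀ t, |c t - 1| ≤ η)
    (hc' : ∀ t, |deriv c t| ≤ η) {x : Plane} (hx : |x 1| ≤ 1) :
    |logSlope c x| ≤ 2 * η ∧ |shear c x| ≤ 2 * η ∧ |shear c x * logSlope c x| ≤ 2 * η ∧
      |verticalDefect c x| ≤ 12 * η := by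
  have hη0 : 0 ≤ η := (abs_nonneg _).trans (hc1 0)
  have hlow : 1 / 2 ≤ c (x 0) := by linarith [(abs_le.1 (hc1 (x 0))).1]
  have hpos : 0 < c (x 0) := by linarith
  have hinv : |(c (x 0))⁻¹| ≤ 2 := by
    rw [abs_of_pos (inv_pos.2 hpos)]
    simpa using inv_anti₀ (by norm_num) hlow
  have hq : |logSlope c x| ≤ 2 * η := by
    rw [logSlope, abs_mul, mul_comm]
    exact mul_le_mul hinv (hc' _) (abs_nonneg _) (by norm_num)
  have hr : |shear c x| ≤ 2 * η := by
    rw [shear, abs_mul]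
    exact (mul_le_of_le_one_left (abs_nonneg _) hx).trans hq
  refine ⟨hq, hr, ?_, (abs_add_le _ _).trans ?_⟩
  · rw [abs_mul]
    nlinarith [mul_le_mul hr hq (abs_nonneg _) (by positivity)]
  · have h1 : |shear c x ^ 2| ≤ 2 * η := by
      rw [pow_two, abs_mul]
      nlinarith [mul_le_mul hr hr (abs_nonneg _) (by positivity)]
    have h2 : |(c (x 0))⁻¹ ^ 2 - 1| ≤ 10 * η := by
      -- Factoring out c - 1 exhibits the smallness; the remaining factor is at most 2 · 3, so 10 is
      -- not sharp.
      have e : (c (x 0))⁻¹ ^ 2 - 1 =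
          -((c (x 0) - 1) * ((c (x 0))⁻¹ * ((c (x 0))⁻¹ + 1))) := by
        have := hpos.ne'
        field_simp
        ring
      rw [e, abs_neg, abs_mul, abs_mul]
      have h3 : |(c (x 0))⁻¹ + 1| ≤ 3 := by
        refine (abs_add_le _ _).trans ?_
        rw [abs_one]
        linarith
      have h4 := mul_le_mul hinv h3 (abs_nonneg _) (by norm_num)
      have h5 := mul_le_mul (hc1 (x 0)) h4 (by positivity) hη0
      linarith
    linarith

/-- The Jacobian cancels one factor 1/c of ψ/c. The two terms containing ψ undifferentiated come
from the derivative of 1/c. -/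
lemma pulledBack_integrand_stretch (hpos : ∀ t, 0 < c t) (u0 u1 ψ ψ0 ψ1 : ℂ) (x : Plane) :
    ((u0 - (x 1 * deriv c (x 0) * (c (x 0))⁻¹ : ℝ) * u1) *
        ((((c (x 0))⁻¹ : ℝ) * ψ0 - (deriv c (x 0) * (c (x 0))⁻¹ * (c (x 0))⁻¹ : ℝ) * ψ) -
          (x 1 * deriv c (x 0) * (c (x 0))⁻¹ : ℝ) * (((c (x 0))⁻¹ : ℝ) * ψ1)) +
      ((c (x 0))⁻¹ : ℝ) * u1 * (((c (x 0))⁻¹ : ℝ) * (((c (x 0))⁻¹ : ℝ) * ψ1))) *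
        (c (x 0) : ℂ) =
    (u0 * ψ0 + u1 * ψ1) + ((-logSlope c x : ℝ) * (u0 * ψ) + (-shear c x : ℝ) * (u0 * ψ1) +
      (-shear c x : ℝ) * (u1 * ψ0) + (shear c x * logSlope c x : ℝ) * (u1 * ψ) +
      (verticalDefect c x : ℝ) * (u1 * ψ1)) := by
  have hcx : (c (x 0) : ℂ) ≠ 0 := by exact_mod_cast (hpos (x 0)).ne'
  simp only [verticalDefect, shear, logSlope]
  push_cast
  field_simp
  ring

lemma integrable_bdd_mul_mul (hU : IsOpen U) {m : Plane → ℝ} (hm : Continuous m) {K : ℝ}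
    (hK : ∀ x ∈ U, |m x| ≤ K) {f g : Plane → ℂ} (hf : MemLp f 2 (volume.restrict U))
    (hg : MemLp g 2 (volume.restrict U)) :
    Integrable (fun x => (m x : ℂ) * (f x * g x)) (volume.restrict U) :=
  (hf.integrable_mul hg).bdd_mul (Complex.continuous_ofReal.comp hm).aestronglyMeasurable
    (ae_norm_ofReal_le hU hK)

section Estimates

variable {η : ℝ}

lemma pulledBackForm_stretch (hc : ContDiff ℝ ∞ c) (hη : η ≤ 1 / 2) (hc1 : ∀ t, |c t - 1| ≤ η)
    (hc' : ∀ t, |deriv c t| ≤ η) (hU : IsOpen U) (hU1 : ∀ x ∈ U, |x 1| ≤ 1) (a : ℝ)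
    (u ψ : H1 U) :
    pulledBackForm a (stretch c) U u ψ = unperturbedForm a U u ψ +
      ((∫ x in U, ((-logSlope c x : ℝ) : ℂ) * (u.grad x 0 * ψ.val x)) +
       (∫ x in U, ((-shear c x : ℝ) : ℂ) * (u.grad x 0 * ψ.grad x 1)) +
       (∫ x in U, ((-shear c x : ℝ) : ℂ) * (u.grad x 1 * ψ.grad x 0)) +
       (∫ x in U, ((shear c x * logSlope c x : ℝ) : ℂ) * (u.grad x 1 * ψ.val x)) +
       (∫ x in U, ((verticalDefect c x : ℝ) : ℂ) * (u.grad x 1 * ψ.grad x 1))) := by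
  have hlow : ∀ t, 1 / 2 ≤ c t := fun t => by linarith [(abs_le.1 (hc1 t)).1]
  have hup : ∀ t, c t ≤ 3 / 2 := fun t => by linarith [(abs_le.1 (hc1 t)).2]
  have hpos : ∀ t, 0 < c t := fun t => by linarith [hlow t]
  have hb : ∀ x ∈ U, _ := fun x hx => coefficient_bounds hη hc1 hc' (hU1 x hx)
  have hqc := continuous_logSlope hc hpos
  have hrc := continuous_shear hc hpos
  have hkc := continuous_verticalDefect hc hpos
  have hu := (memH1_pushForward_stretch hc (by norm_num) hlow hc' hup hU hU1 u.val_memLp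
    u.grad_memLp u.isWeakGradient).2
  have hψ := (memH1_pushForward_stretch hc (by norm_num) hlow hc' hup hU hU1
    (divJacobian_stretch_memLp hc (by norm_num) hlow ψ.val_memLp)
    (divGrad_memLp hc (by norm_num) hlow hc' ψ.val_memLp ψ.grad_memLp)
    (ψ.isWeakGradient.divJacobian_stretch hc hpos ψ.val_memLp ψ.grad_memLp)).2
  have i0 : Integrable (fun x => ∑ i, u.grad x i * ψ.grad x i) (volume.restrict U) :=
    integrable_finsetSum _ fun i _ => u.integrable_grad_mul ψ i i
  have g := coord_memLp u.grad_memLp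
  have g' := coord_memLp ψ.grad_memLp
  have key := integral_add_six i0
    (integrable_bdd_mul_mul hU hqc.neg (fun x hx => (abs_neg _).trans_le (hb x hx).1)
      (g 0) ψ.val_memLp)
    (integrable_bdd_mul_mul hU hrc.neg (fun x hx => (abs_neg _).trans_le (hb x hx).2.1)
      (g 0) (g' 1))
    (integrable_bdd_mul_mul hU hrc.neg (fun x hx => (abs_neg _).trans_le (hb x hx).2.1)
      (g 1) (g' 0))
    (integrable_bdd_mul_mul hU (hrc.mul hqc) (fun x hx => (hb x hx).2.2.1) (g 1) ψ.val_memLp)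
    (integrable_bdd_mul_mul hU hkc (fun x hx => (hb x hx).2.2.2) (g 1) (g' 1))
  -- The zero-order term a∫uψ is the same in both forms, so only the gradient integrals need
  -- comparing.
  have aux : ∀ X Y d z : ℂ, X = Y + d → X + z = Y + z + d := fun X Y d z h => by rw [h]; ring
  refine aux _ _ _ _ (Eq.trans (integral_congr_ae ?_) key)
  filter_upwards [hu, hψ] with x e1 e2
  rw [e1, e2, absJacobian_stretch hc hpos, Fin.sum_univ_two, Fin.sum_univ_two]
  exact pulledBack_integrand_stretch hpos _ _ _ _ _ x

/-- The pulled back form of a map `(x₁, x₂ c(x₁))` is a perturbation of the unperturbed form which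
is small together with `c - 1` and `c'`. -/
lemma exists_perturbation (hc : ContDiff ℝ ∞ c) (hη : η ≤ 1 / 2) (hc1 : ∀ t, |c t - 1| ≤ η)
    (hc' : ∀ t, |deriv c t| ≤ η) (hU : IsOpen U) (hU1 : ∀ x ∈ U, |x 1| ≤ 1) (a : ℝ) :
    ∃ D : H1 U →L[ℂ] Hneg1 U,
      (∀ u ψ, pulledBackForm a (stretch c) U u ψ = unperturbedForm a U u ψ + D u ψ) ∧
      ∀ u, ‖D u‖ ≤ 20 * η * ‖u‖ := by
  have hη0 : 0 ≤ η := (abs_nonneg _).trans (hc1 0)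
  have hpos : ∀ t, 0 < c t := fun t => by linarith [(abs_le.1 (hc1 t)).1]
  have hb : ∀ x ∈ U, _ := fun x hx => coefficient_bounds hη hc1 hc' (hU1 x hx)
  have hη2 : 0 ≤ 2 * η := by positivity
  have hη12 : 0 ≤ 12 * η := by positivity
  have hqc := continuous_logSlope hc hpos
  have hrc := continuous_shear hc hpos
  have hkc := continuous_verticalDefect hc hpos
  have m1 : ∀ x ∈ U, |-logSlope c x| ≤ 2 * η := fun x hx =>
    (abs_neg _).trans_le (hb x hx).1
  have m2 : ∀ x ∈ U, |-shear c x| ≤ 2 * η := fun x hx => (abs_neg _).trans_le (hb x hx).2.1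
  have m3 : ∀ x ∈ U, |shear c x * logSlope c x| ≤ 2 * η := fun x hx => (hb x hx).2.2.1
  have m4 : ∀ x ∈ U, |verticalDefect c x| ≤ 12 * η := fun x hx => (hb x hx).2.2.2
  have hP : ∀ i (u : H1 U), ‖H1.partialL U i u‖ ≤ ‖u‖ := H1.norm_partialL_le
  have hI : ∀ u : H1 U, ‖H1.toL2 U u‖ ≤ ‖u‖ := H1.norm_toL2_le
  -- One bounded form for each extra term; the norm bounds add up to 2 + 2 + 2 + 2 + 12 = 20.
  refine ⟨weightedForm hU hqc.neg hη2 m1 (H1.partialL U 0) (H1.toL2 U) +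
    weightedForm hU hrc.neg hη2 m2 (H1.partialL U 0) (H1.partialL U 1) +
    weightedForm hU hrc.neg hη2 m2 (H1.partialL U 1) (H1.partialL U 0) +
    weightedForm hU (hrc.mul hqc) hη2 m3 (H1.partialL U 1) (H1.toL2 U) +
    weightedForm hU hkc hη12 m4 (H1.partialL U 1) (H1.partialL U 1), fun u ψ => ?_, fun u => ?_⟩
  · have hu := fun i => u.partialL_ae_eq i
    have hψ := fun i => ψ.partialL_ae_eq i
    have hψ0 : H1.toL2 U ψ =ᵐ[volume.restrict U] ψ.val := ae_eq_refl _
    refine (pulledBackForm_stretch hc hη hc1 hc' hU hU1 a u ψ).trans ?_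
    exact congrArg _ (congrArg₂ _ (congrArg₂ _ (congrArg₂ _ (congrArg₂ _
      (weightedForm_apply_of_ae hU hqc.neg hη2 m1 _ _ (hu 0) hψ0).symm
      (weightedForm_apply_of_ae hU hrc.neg hη2 m2 _ _ (hu 0) (hψ 1)).symm)
      (weightedForm_apply_of_ae hU hrc.neg hη2 m2 _ _ (hu 1) (hψ 0)).symm)
      (weightedForm_apply_of_ae hU (hrc.mul hqc) hη2 m3 _ _ (hu 1) hψ0).symm)
      (weightedForm_apply_of_ae hU hkc hη12 m4 _ _ (hu 1) (hψ 1)).symm)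
  · refine (norm_add_five_le (X := Hneg1 U)
      (norm_weightedForm_le hU hqc.neg hη2 m1 _ _ (hP 0) hI u)
      (norm_weightedForm_le hU hrc.neg hη2 m2 _ _ (hP 0) (hP 1) u)
      (norm_weightedForm_le hU hrc.neg hη2 m2 _ _ (hP 1) (hP 0) u)
      (norm_weightedForm_le hU (hrc.mul hqc) hη2 m3 _ _ (hP 1) hI u)
      (norm_weightedForm_le hU hkc hη12 m4 _ _ (hP 1) (hP 1) u)).trans (le_of_eq ?_)
    ring

end Estimates

end Perturbation

/-! ### Unbounded operators in H⁻¹ with domain H¹. -/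

section Operators

variable {U : Set Plane}

/-- The operator in `H⁻¹(U)` with domain `H¹(U)` of a bounded operator `H¹(U) → H⁻¹(U)`. -/
def operatorInHneg1 (hU : IsOpen U) (S : H1 U →L[ℂ] Hneg1 U) : Hneg1 U →ₗ.[ℂ] Hneg1 U :=
  operatorThrough (H1.toHneg1L U).toLinearMap S.toLinearMap (H1.toHneg1_injective hU)

lemma operatorInHneg1_apply (hU : IsOpen U) (S : H1 U →L[ℂ] Hneg1 U) (u : H1 U)
    (hu : H1.toHneg1 U u ∈ (operatorInHneg1 hU S).domain) :
    operatorInHneg1 hU S ⟨H1.toHneg1 U u, hu⟩ = S u :=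
  operatorThrough_apply (H1.toHneg1L U).toLinearMap S.toLinearMap (H1.toHneg1_injective hU) u hu

lemma isOperatorOfForm_operatorInHneg1 (hU : IsOpen U) {S : H1 U →L[ℂ] Hneg1 U}
    {B : H1 U → H1 U → ℂ} (h : ∀ u ψ, B u ψ = S u ψ) :
    IsOperatorOfForm B (operatorInHneg1 hU S) where
  domain_eq := rfl
  apply_eq u hu ψ := by rw [operatorInHneg1_apply, h]

lemma isSectorial_operatorInHneg1 (hU : IsOpen U) {S : H1 U →L[ℂ] Hneg1 U} {k : ℝ} (hk : 0 < k)
    (hS : ∀ u, k * ‖u‖ ^ 2 ≤ (S u u.conj).re) :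
    IsSectorial (X := Hneg1 U) (operatorInHneg1 hU S) :=
  isSectorial_operatorThrough (H1.toHneg1L U) S (H1.toHneg1_injective hU)
    (H1.denseRange_toHneg1L hU) H1.conj_conj (fun u => u.norm_conj.le)
    (fun u => ⟨_, sq_nonneg _, u.toHneg1L_conj⟩) hk hS

end Operators

/-! ### The unit square and the oscillating factor. -/

lemma isOpen_unitSquare : IsOpen unitSquare := by
  have : unitSquare = ⋂ i, (fun x : Plane => x i) ⁻¹' Ioo (0 : ℝ) 1 := by
    ext x
    simp [unitSquare]
  rw [this]
  exact isOpen_iInter_of_finite fun i => isOpen_Ioo.preimage (by fun_prop)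

lemma abs_le_one_of_mem_unitSquare {x : Plane} (hx : x ∈ unitSquare) : |x 1| ≤ 1 :=
  abs_le.2 ⟨by linarith [(hx 1).1], (hx 1).2.le⟩

/-- The vertical scaling factor of `hMap`. -/
def verticalFactor (α ε t : ℝ) : ℝ := 1 + ε * Real.sin (t / ε ^ α)

lemma hMap_eq_stretch (α ε : ℝ) : hMap α ε = stretch (verticalFactor α ε) := by
  ext x i
  fin_cases i
  · rfl
  · simp [hMap, stretch, verticalFactor]
    ring

lemma contDiff_verticalFactor (α ε : ℝ) : ContDiff ℝ ∞ (verticalFactor α ε) := by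
  unfold verticalFactor
  simp only [div_eq_mul_inv]
  fun_prop

lemma abs_verticalFactor_sub_one_le (α t : ℝ) {ε : ℝ} (hε : 0 < ε) :
    |verticalFactor α ε t - 1| ≤ ε := by
  rw [verticalFactor, add_sub_cancel_left, abs_mul, abs_of_pos hε]
  exact mul_le_of_le_one_right hε.le (Real.abs_sin_le_one _)

/-- Differentiating the sine costs a factor ε^(-α) against the amplitude ε. -/
lemma abs_deriv_verticalFactor_le (α t : ℝ) {ε : ℝ} (hε : 0 < ε) :
    |deriv (verticalFactor α ε) t| ≤ ε ^ (1 - α) := by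
  have h1 : HasDerivAt (verticalFactor α ε) (ε * (Real.cos (t / ε ^ α) * (1 / ε ^ α))) t :=
    ((((hasDerivAt_id t).div_const (ε ^ α)).sin).const_mul ε).const_add 1
  have h2 : ε * (Real.cos (t / ε ^ α) * (1 / ε ^ α)) =
      Real.cos (t / ε ^ α) * ε ^ (1 - α) := by
    rw [Real.rpow_sub hε, Real.rpow_one]
    ring
  rw [h1.deriv, h2, abs_mul, abs_of_pos (Real.rpow_pos_of_pos hε _)]
  exact mul_le_of_le_one_left (Real.rpow_nonneg hε.le _) (Real.abs_cos_le_one _)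

/-! ### Stability of coercivity and relative bounds. -/

section PerturbedOperator

variable {U : Set Plane}

/-- Conjugation preserves the norm, so D changes the real part by at most κ‖u‖², which is at most
half of the coercivity. -/
lemma perturbed_coercive (a : ℝ) {D : H1 U →L[ℂ] Hneg1 U} {κ : ℝ}
    (hD : ∀ u, ‖D u‖ ≤ κ * ‖u‖) (hκ : κ ≤ min 1 a / 2) (u : H1 U) :
    min 1 a / 2 * ‖u‖ ^ 2 ≤ ((unperturbedL a U + D) u u.conj).re := by
  have h1 := unperturbedL_coercive a u
  have h2 : ‖D u u.conj‖ ≤ κ * ‖u‖ * ‖u‖ :=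
    ((D u).le_opNorm_of_le u.norm_conj.le).trans
      (mul_le_mul_of_nonneg_right (hD u) (norm_nonneg _))
  have h3 := (abs_le.1 ((Complex.abs_re_le_norm _).trans h2)).1
  have h4 : κ * ‖u‖ * ‖u‖ ≤ min 1 a / 2 * ‖u‖ ^ 2 := by
    rw [mul_assoc, ← pow_two]
    exact mul_le_mul_of_nonneg_right hκ (sq_nonneg _)
  change _ ≤ (unperturbedL a U u u.conj + D u u.conj).re
  rw [Complex.add_re]
  linarith

lemma norm_perturbation_le {a : ℝ} (ha : 0 < a) {D : H1 U →L[ℂ] Hneg1 U} {κ : ℝ} (hκ : 0 ≤ κ)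
    (hD : ∀ u, ‖D u‖ ≤ κ * ‖u‖) (u : H1 U) :
    ‖D u‖ ≤ κ / min 1 a * ‖unperturbedL a U u‖ := by
  rw [div_mul_eq_mul_div, le_div_iff₀ (lt_min one_pos ha)]
  calc ‖D u‖ * min 1 a ≤ κ * ‖u‖ * min 1 a :=
        mul_le_mul_of_nonneg_right (hD u) (lt_min one_pos ha).le
    _ = κ * (min 1 a * ‖u‖) := by ring
    _ ≤ _ := mul_le_mul_of_nonneg_left (unperturbedL_lower_bound a u) hκ

lemma norm_operatorInHneg1_sub_le (hU : IsOpen U) {S D : H1 U →L[ℂ] Hneg1 U} {t : ℝ}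
    (h : ∀ u, ‖D u‖ ≤ t * ‖S u‖) (f : Hneg1 U) (hf : f ∈ (operatorInHneg1 hU (S + D)).domain)
    (hf₀ : f ∈ (operatorInHneg1 hU S).domain) :
    ‖operatorInHneg1 hU (S + D) ⟨f, hf⟩ - operatorInHneg1 hU S ⟨f, hf₀⟩‖ ≤
      t * ‖operatorInHneg1 hU S ⟨f, hf₀⟩‖ := by
  have hf' : ∃ u, H1.toHneg1 U u = f := hf
  refine hf'.elim fun u hu => ?_
  subst hu
  have h1 := operatorInHneg1_apply hU (S + D) u hf
  have h2 := operatorInHneg1_apply hU S u hf₀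
  have h3 : operatorInHneg1 hU (S + D) ⟨_, hf⟩ - operatorInHneg1 hU S ⟨_, hf₀⟩ = D u :=
    (congrArg₂ (· - ·) h1 h2).trans (add_sub_cancel_left (S u) (D u))
  exact (congrArg norm h3).trans_le ((h u).trans_eq (congrArg (t * ‖·‖) h2.symm))

/-- `B` is an operator of the pulled back form of `h` which is sectorial and `t`-close to the
unperturbed operator. -/
structure IsClosePulledBackOperator (a : ℝ) (h : Plane → Plane) (hU : IsOpen U) (t : ℝ)
    (B : Hneg1 U →ₗ.[ℂ] Hneg1 U) : Prop where
  wellDefined : PulledBackFormWellDefined h U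
  isOperatorOfForm : IsOperatorOfForm (pulledBackForm a h U) B
  isSectorial : IsSectorial (X := Hneg1 U) B
  norm_sub_le : ∀ (f : Hneg1 U) (hf : f ∈ B.domain)
    (hf₀ : f ∈ (operatorInHneg1 hU (unperturbedL a U)).domain),
    ‖B ⟨f, hf⟩ - operatorInHneg1 hU (unperturbedL a U) ⟨f, hf₀⟩‖ ≤
      t * ‖operatorInHneg1 hU (unperturbedL a U) ⟨f, hf₀⟩‖

lemma IsClosePulledBackOperator.of_form {a : ℝ} (ha : 0 < a) {h : Plane → Plane} (hU : IsOpen U)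
    (hw : PulledBackFormWellDefined h U) {D : H1 U →L[ℂ] Hneg1 U} {κ : ℝ} (hκ : 0 ≤ κ)
    (hκ' : κ ≤ min 1 a / 2)
    (hD : ∀ u ψ, pulledBackForm a h U u ψ = unperturbedForm a U u ψ + D u ψ)
    (hDb : ∀ u, ‖D u‖ ≤ κ * ‖u‖) :
    IsClosePulledBackOperator a h hU (κ / min 1 a) (operatorInHneg1 hU (unperturbedL a U + D)) where
  wellDefined := hw
  isOperatorOfForm := isOperatorOfForm_operatorInHneg1 hU fun u ψ =>
    (hD u ψ).trans (congrArg (· + D u ψ) (unperturbedL_apply a u ψ).symm)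
  isSectorial := isSectorial_operatorInHneg1 hU (half_pos (lt_min one_pos ha))
    (perturbed_coercive a hDb hκ')
  norm_sub_le := norm_operatorInHneg1_sub_le hU (norm_perturbation_le ha hκ hDb)

/-- The threshold min(1, a)/40 is what makes κ = 20η at most min(1, a)/2; it also gives η ≤ 1/2. -/
lemma exists_isClosePulledBackOperator_stretch {a : ℝ} (ha : 0 < a) {c : ℝ → ℝ}
    (hc : ContDiff ℝ ∞ c) {η : ℝ} (hη : η ≤ min 1 a / 40) (hc1 : ∀ t, |c t - 1| ≤ η)
    (hc' : ∀ t, |deriv c t| ≤ η) (hU : IsOpen U) (hU1 : ∀ x ∈ U, |x 1| ≤ 1) :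
    ∃ B, IsClosePulledBackOperator a (stretch c) hU (20 * η / min 1 a) B :=
  have hη0 : 0 ≤ η := (abs_nonneg _).trans (hc1 0)
  have hη' : η ≤ 1 / 2 := by linarith [min_le_left 1 a]
  have hw : PulledBackFormWellDefined (stretch c) U :=
    pulledBackFormWellDefined_stretch hc (δ := 1 / 2) (K' := 3 / 2) (by norm_num)
      (fun t => by linarith [(abs_le.1 (hc1 t)).1]) hc'
      (fun t => by linarith [(abs_le.1 (hc1 t)).2]) hU hU1
  (exists_perturbation hc hη' hc1 hc' hU hU1 a).elim fun _ hD =>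
    ⟨_, .of_form ha hU hw (by positivity) (by linarith) hD.1 hD.2⟩

end PerturbedOperator

lemma exists_isClosePulledBackOperator_hMap {a α ε : ℝ} (ha : 0 < a) (hα₀ : 0 < α) (hε : 0 < ε)
    (hε1 : ε < 1) (hε2 : ε ^ (1 - α) < min 1 a / 40) :
    ∃ B, IsClosePulledBackOperator a (hMap α ε) isOpen_unitSquare
      (20 * ε ^ (1 - α) / min 1 a) B := by
  -- For ε < 1 the slope bound dominates the amplitude bound, so a single η serves both.
  have hεη : ε ≤ ε ^ (1 - α) := by
    have := Real.rpow_le_rpow_of_exponent_ge hε hε1.le (by linarith : 1 - α ≤ 1)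
    rwa [Real.rpow_one] at this
  rw [hMap_eq_stretch]
  exact exists_isClosePulledBackOperator_stretch ha (contDiff_verticalFactor α ε) hε2.le
    (fun t => (abs_verticalFactor_sub_one_le α t hε).trans hεη)
    (fun t => abs_deriv_verticalFactor_le α t hε) isOpen_unitSquare
    (fun x hx => abs_le_one_of_mem_unitSquare hx)

lemma tendsto_rpow_nhdsGT_zero {r : ℝ} (hr : 0 < r) :
    Tendsto (fun ε : ℝ => ε ^ r) (𝓝[>] 0) (𝓝 0) := by
  have h1 := (Real.continuousAt_rpow_const 0 r (Or.inr hr.le)).tendsto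
  rw [Real.zero_rpow hr.ne'] at h1
  exact h1.mono_left nhdsWithin_le_nhds

lemma exists_pos_forall_rpow_lt {r δ : ℝ} (hr : 0 < r) (hδ : 0 < δ) :
    ∃ ε₀ : ℝ, 0 < ε₀ ∧ ∀ ε ∈ Ioo 0 ε₀, ε < 1 ∧ ε ^ r < δ := by
  have hev : ∀ᶠ ε : ℝ in 𝓝[>] 0, ε < 1 ∧ ε ^ r < δ :=
    (Filter.Eventually.filter_mono nhdsWithin_le_nhds (gt_mem_nhds one_pos)).and
      ((tendsto_rpow_nhdsGT_zero hr).eventually (gt_mem_nhds hδ))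
  obtain ⟨ε₀, hε₀, hsub⟩ := mem_nhdsGT_iff_exists_Ioo_subset.1 hev
  exact ⟨ε₀, hε₀, hsub⟩

end

theorem mainTheorem7 (a α : ℝ) (ha : 0 < a) (hα₀ : 0 < α) (hα₁ : α < 1) :
    ∃ ε₀ : ℝ, 0 < ε₀ ∧
    ∃ (A : Hneg1 unitSquare →ₗ.[ℂ] Hneg1 unitSquare)
      (Aε : ℝ → (Hneg1 unitSquare →ₗ.[ℂ] Hneg1 unitSquare))
      (τ : ℝ → ℝ),
      IsOperatorOfForm (unperturbedForm a unitSquare) A ∧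
      (∀ ε ∈ Set.Ioo 0 ε₀,
        PulledBackFormWellDefined (hMap α ε) unitSquare ∧
        IsOperatorOfForm (pulledBackForm a (hMap α ε) unitSquare) (Aε ε) ∧
        IsSectorial (X := Hneg1 unitSquare) (Aε ε)) ∧
      (∀ ε ∈ Set.Ioo 0 ε₀, 0 < τ ε) ∧
      Filter.Tendsto τ (nhdsWithin 0 (Set.Ioi 0)) (nhds 0) ∧
      (∀ ε ∈ Set.Ioo 0 ε₀, ∀ (f : Hneg1 unitSquare) (hf : f ∈ (Aε ε).domain) (hf₀ : f ∈ A.domain),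
        ‖Aε ε ⟨f, hf⟩ - A ⟨f, hf₀⟩‖ ≤ τ ε * ‖A ⟨f, hf₀⟩‖) := by
  have hm0 : 0 < min 1 a := lt_min one_pos ha
  have hr : 0 < 1 - α := by linarith
  -- The threshold ε₀ is chosen from 1 - α and min(1, a)/40 only, hence depends only on a and α.
  have hex := exists_pos_forall_rpow_lt hr (by positivity : 0 < min 1 a / 40)
  have hε₀ := hex.choose_spec
  have main : ∀ ε ∈ Ioo 0 hex.choose, ∃ B, IsClosePulledBackOperator a (hMap α ε)
      isOpen_unitSquare (20 * ε ^ (1 - α) / min 1 a) B := fun ε hε =>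
    exists_isClosePulledBackOperator_hMap ha hα₀ hε.1 (hε₀.2 ε hε).1 (hε₀.2 ε hε).2
  -- Outside (0, ε₀) the operator B takes an arbitrary value, about which nothing is claimed.
  choose! B hB using main
  refine ⟨hex.choose, hε₀.1, operatorInHneg1 isOpen_unitSquare (unperturbedL a unitSquare), B,
    fun ε => 20 * ε ^ (1 - α) / min 1 a,
    isOperatorOfForm_operatorInHneg1 _ fun u ψ => (unperturbedL_apply a u ψ).symm,
    fun ε hε => ⟨(hB ε hε).wellDefined, (hB ε hε).isOperatorOfForm, (hB ε hε).isSectorial⟩,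
    fun ε hε => ?_, ?_, fun ε hε => (hB ε hε).norm_sub_le⟩
  · have := Real.rpow_pos_of_pos hε.1 (1 - α)
    positivity
  · simpa using ((tendsto_rpow_nhdsGT_zero hr).const_mul 20).div_const (min 1 a)
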